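/- Let $\mathcal S$ be the following triangulation, with one vertex, 10 edges and 10 tetrahedra $0,\dots,9$, whose space with the vertex removed is (the interior of) the exterior $B$ of the knot K13n586. Each tetrahedron has vertices $0,1,2,3$, and its face $\mathrm F_f$ is the one opposite to vertex $f$. An entry $T'(p_0p_1p_2p_3)$ in row $T$, column $\mathrm F_f$ of the table says that face $\mathrm F_f$ of tetrahedron $T$ is glued affinely to tetrahedron $T'$, each vertex $i\neq f$ going to vertex $p_i$ of $T'$: $$\begin{array}{c|cccc} & \mathrm F_0 & \mathrm F_1 & \mathrm F_2 & \mathrm F_3\\ \hline 0 & 2(0132) & 1(0132) & 7(0213) & 5(2103) \\ 1 & 4(3012) & 0(0132) & 6(3120) & 3(0132) \\ 2 & 0(0132) & 5(0213) & 3(1302) & 9(3120) \\ 3 & 2(2031) & 9(0132) & 1(0132) & 8(2103) \\ 4 & 7(3120) & 8(0132) & 9(3120) & 1(1230) \\ 5 & 7(0132) & 6(0132) & 2(0213) & 0(2103) \\ 6 & 9(3012) & 5(0132) & 1(3120) & 8(0132) \\ 7 & 5(0132) & 0(0213) & 8(1302) & 4(3120) \\ 8 & 7(2031) & 4(0132)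 & 6(0132) & 3(2103) \\ 9 & 2(3120) & 3(0132) & 4(3120) & 6(1230) \end{array}$$ The space $|\mathcal S|$ is the quotient of the disjoint union of the ten tetrahedra by these gluings. An elementary triangle at vertex $i$ of a tetrahedron is the convex hull of one interior point on each of the three edges at $i$. An elementary quadrilateral (of the only type used here) has as corners interior points of the edges $02,12,13,03$, in this cyclic order, so that it separates edge $01$ from edge $23$; it is the cone from the centroid of its corners over the closed polygon through them (the planar quadrilateral, if the corners are coplanar). A normal surface with normal coordinates $c=(t_0,t_1,t_2,t_3,q)_T$ is a subset of $|\mathcal S|$ that meets each tetrahedron $T$ in a disjoint union of elementary disks, namely exactly $t_i$ triangles at vertex $i$ ($i=0,\dots,3$) and $q$ quadrilaterals. Let $F$ and $G$ be the normal surfaces (both of genus 2) with the normal coordinates $$\begin{array}{c|cc} T & F & G\\ \hline 0 & (2,0,0,0,2) & (2,0,2,0,0) \\ 1 & (3,1,0,0,1) & (1,1,0,2,1) \\ 2 & (1,1,0,0,1) & (2,0,0,2,0) \\ 3 & (3,1,1,1,0) & (1,1,2,0,1) \\ 4 & (2,0,0,2,0) & (2,0,1,1,1) \\ 5 & (2,0,2,0,0)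 & (2,0,0,0,2) \\ 6 & (1,1,0,2,1) & (3,1,0,0,1) \\ 7 & (2,0,0,2,0) & (1,1,0,0,1) \\ 8 & (1,1,2,0,1) & (3,1,1,1,0) \\ 9 & (2,0,1,1,1) & (2,0,0,2,0) \end{array}$$ and for $u,v\in\mathbb N=\{0,1,2,\dots\}$ let the normal sum $uF+vG$ be the normal surface whose normal coordinates are $u$ times those of $F$ plus $v$ times those of $G$. If $\gcd(u,v)=1$, then $uF+vG$ is a connected surface; that is, a normal surface with these normal coordinates exists, and every normal surface with these normal coordinates is connected. -/

import Mathlib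

namespace NormalSurfaces

/-- Face-pairing data for `n` tetrahedra, each with vertices `0, 1, 2, 3`; face `f` is the one
opposite to vertex `f`.  Face `f` of tetrahedron `T` is glued to a face of tetrahedron `tet T f`, and
each vertex `i ≠ f` of that face is glued to vertex `vert T f i`.  The redundant value `vert T f f`
is the index of the face of `tet T f` that is used. -/
structure FaceGluing (n : ℕ) where
  tet : Fin n → Fin 4 → Fin n
  vert : Fin n → Fin 4 → Fin 4 → Fin 4
  tet_tet : ∀ T f, tet (tet T f) (vert T f f) = T
  vert_vert : ∀ T f i, vert (tet T f) (vert T f f) (vert T f i) = i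
  ne_self : ∀ T f, (tet T f, vert T f f) ≠ (T, f)

namespace FaceGluing

variable {n : ℕ}

/-- The identifications of points of the disjoint union of the `n` standard tetrahedra (in
barycentric coordinates) that are made by the affine gluing maps of the faces. -/
def Glued (𝒯 : FaceGluing n) (a b : Fin n × stdSimplex ℝ (Fin 4)) : Prop :=
  ∃ f : Fin 4, a.2 f = 0 ∧ b.1 = 𝒯.tet a.1 f ∧ ∀ i, b.2 (𝒯.vert a.1 f i) = a.2 i

/-- The triangulated space: the disjoint union of the tetrahedra modulo the face gluings, with the
quotient topology. -/
abbrev Space (𝒯 : FaceGluing n) : Type := Quot 𝒯.Glued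

/-- The characteristic map of the tetrahedron `T`. -/
def charMap (𝒯 : FaceGluing n) (T : Fin n) (x : stdSimplex ℝ (Fin 4)) : 𝒯.Space :=
  Quot.mk 𝒯.Glued (T, x)

end FaceGluing

/-- The disk types in a tetrahedron that we use: the triangle cutting off the vertex `i`, and the
quadrilateral separating the edge `01` from the edge `23`. -/
inductive DiskType where
  | tri (i : Fin 4) : DiskType
  | quad : DiskType

/-- The point at parameter `s` on the edge from vertex `i` to vertex `j` of the standard
tetrahedron. -/
noncomputable def edgePoint (i j : Fin 4) (s : ℝ) : Fin 4 → ℝ :=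
  (1 - s) • Pi.single i 1 + s • Pi.single j 1

/-- `D` is an elementary triangle at the vertex `i`: it is spanned by one interior point on each of
the three edges at `i`. -/
def IsElementaryTriangle (i : Fin 4) (D : Set (Fin 4 → ℝ)) : Prop :=
  ∃ s : Fin 4 → ℝ, (∀ j, s j ∈ Set.Ioo (0 : ℝ) 1) ∧
    D = convexHull ℝ {x | ∃ j, j ≠ i ∧ x = edgePoint i j (s j)}

/-- `D` is an elementary quadrilateral separating the edge `01` from the edge `23`.  Its corners, in
cyclic order, are interior points of the edges `02`, `12`, `13`, `03`, and `D` is the cone from the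
centroid of the four corners over the closed polygon through them (if the corners are coplanar, this
cone is the planar quadrilateral). -/
def IsElementaryQuad (D : Set (Fin 4 → ℝ)) : Prop :=
  ∃ (s : Fin 4 → ℝ) (p : Fin 4 → Fin 4 → ℝ) (b : Fin 4 → ℝ),
    (∀ k, s k ∈ Set.Ioo (0 : ℝ) 1) ∧
    p = ![edgePoint 0 2 (s 0), edgePoint 1 2 (s 1), edgePoint 1 3 (s 2), edgePoint 0 3 (s 3)] ∧
    b = (1 / 4 : ℝ) • ∑ k, p k ∧
    D = ⋃ k : Fin 4, convexHull ℝ {b, p k, p (k + 1)}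

/-- `D` is an elementary disk of the given type. -/
def IsElementaryDisk : DiskType → Set (Fin 4 → ℝ) → Prop
  | .tri i, D => IsElementaryTriangle i D
  | .quad, D => IsElementaryQuad D

/-- Normal coordinates: the number of elementary disks of each type in each tetrahedron.  The normal
sum of normal surfaces corresponds to the sum of their normal coordinates. -/
abbrev NormalCoord (n : ℕ) : Type := Fin n → DiskType → ℕ

/-- `S` is a normal surface with normal coordinates `c`: it meets each tetrahedron `T` in a disjoint
union of elementary disks, of which exactly `c T t` have type `t`. -/
def IsNormalSurface {n : ℕ} (𝒯 : FaceGluing n) (c : NormalCoord n) (S : Set 𝒯.Space) : Prop :=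
  ∀ T : Fin n, ∃ D : ((t : DiskType) × Fin (c T t)) → Set (Fin 4 → ℝ),
    (∀ a, IsElementaryDisk a.1 (D a)) ∧
    (∀ a b, a ≠ b → Disjoint (D a) (D b)) ∧
    ∀ x : stdSimplex ℝ (Fin 4), 𝒯.charMap T x ∈ S ↔ ∃ a, (x : Fin 4 → ℝ) ∈ D a

/-- Normal coordinates from a table whose rows are the tetrahedra and whose columns are
tri0, tri1, tri2, tri3, quad. -/
def NormalCoord.ofTable {n : ℕ} (M : Fin n → Fin 5 → ℕ) : NormalCoord n
  | T, .tri i => M T i.castSucc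
  | T, .quad => M T 4

/-- The one-vertex triangulation with 10 tetrahedra of the exterior of the knot K13n586 (an ideal
triangulation: the exterior corresponds to the complement of the vertex). -/
def triangulationB : FaceGluing 10 where
  tet := ![
    ![2, 1, 7, 5],
    ![4, 0, 6, 3],
    ![0, 5, 3, 9],
    ![2, 9, 1, 8],
    ![7, 8, 9, 1],
    ![7, 6, 2, 0],
    ![9, 5, 1, 8],
    ![5, 0, 8, 4],
    ![7, 4, 6, 3],
    ![2, 3, 4, 6]]
  vert := ![
    ![![0, 1, 3, 2], ![0, 1, 3, 2], ![0, 2, 1, 3], ![2, 1, 0, 3]],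
    ![![3, 0, 1, 2], ![0, 1, 3, 2], ![3, 1, 2, 0], ![0, 1, 3, 2]],
    ![![0, 1, 3, 2], ![0, 2, 1, 3], ![1, 3, 0, 2], ![3, 1, 2, 0]],
    ![![2, 0, 3, 1], ![0, 1, 3, 2], ![0, 1, 3, 2], ![2, 1, 0, 3]],
    ![![3, 1, 2, 0], ![0, 1, 3, 2], ![3, 1, 2, 0], ![1, 2, 3, 0]],
    ![![0, 1, 3, 2], ![0, 1, 3, 2], ![0, 2, 1, 3], ![2, 1, 0, 3]],
    ![![3, 0, 1, 2], ![0, 1, 3, 2], ![3, 1, 2, 0], ![0, 1, 3, 2]],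
    ![![0, 1, 3, 2], ![0, 2, 1, 3], ![1, 3, 0, 2], ![3, 1, 2, 0]],
    ![![2, 0, 3, 1], ![0, 1, 3, 2], ![0, 1, 3, 2], ![2, 1, 0, 3]],
    ![![3, 1, 2, 0], ![0, 1, 3, 2], ![3, 1, 2, 0], ![1, 2, 3, 0]]]
  tet_tet := by decide
  vert_vert := by decide
  ne_self := by decide

/-- The normal coordinates of the surface `F`. -/
def coordF : NormalCoord 10 := NormalCoord.ofTable ![
  ![2, 0, 0, 0, 2],
  ![3, 1, 0, 0, 1],
  ![1, 1, 0, 0, 1],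
  ![3, 1, 1, 1, 0],
  ![2, 0, 0, 2, 0],
  ![2, 0, 2, 0, 0],
  ![1, 1, 0, 2, 1],
  ![2, 0, 0, 2, 0],
  ![1, 1, 2, 0, 1],
  ![2, 0, 1, 1, 1]]

/-- The normal coordinates of the surface `G`. -/
def coordG : NormalCoord 10 := NormalCoord.ofTable ![
  ![2, 0, 2, 0, 0],
  ![1, 1, 0, 2, 1],
  ![2, 0, 0, 2, 0],
  ![1, 1, 2, 0, 1],
  ![2, 0, 1, 1, 1],
  ![2, 0, 0, 0, 2],
  ![3, 1, 0, 0, 1],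
  ![1, 1, 0, 0, 1],
  ![3, 1, 1, 1, 0],
  ![2, 0, 0, 2, 0]]

end NormalSurfaces

/-!
A surface with the coordinates `uF + vG` exists because they satisfy the matching equations: if
the corners are spaced evenly along every edge, the disks in a tetrahedron are disjoint, and they
fit together across the faces.

Every point of a normal surface `S` is joined inside `S` to a point of `S` on an edge. Inside a
face, the normal arcs around a vertex `i` join the points of `S` on the two edges at `i` in the
order of their distance from `i`. Which edge points are joined by arcs therefore depends only on
the coordinates.

For `uF + vG` all edge points are joined to points of one edge. Number the `2 (u + v)` points on
that edge by residues modulo `2 (u + v)`. Paths of arcs realize the reflections of the first `2 u`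
and of the last `2 v` points, which together are the reflection `x ↦ 2 u - 1 - x` of all residues,
and the translation by `2 u` of the first half. Conjugation by the reflection gives the
translation by `2 u` of the other half. As `u` is coprime to `u + v`, the translations by `2 u`
and `2 (u + v)` generate the translation by `2`, and the reflection changes parity; so all points
are joined.
-/

namespace NormalSurfaces

open Finset unitInterval

/-! ### Elementary disks in a tetrahedron -/

section Disk

variable {p q : Fin 4 → Fin 4 → ℝ} {t : DiskType} {f i j k : Fin 4} {x : Fin 4 → ℝ}

theorem edgePoint_apply (i j l : Fin 4) (s : ℝ) :
    edgePoint i j s l = (1 - s) * (if l = i then 1 else 0) + s * (if l = j then 1 else 0) := by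
  simp [edgePoint, Pi.single_apply]

theorem edgePoint_symm (i j : Fin 4) (s : ℝ) : edgePoint i j s = edgePoint j i (1 - s) := by
  rw [edgePoint, edgePoint, sub_sub_cancel, add_comm]

theorem edgePoint_mem_stdSimplex (i j : Fin 4) {s : ℝ} (hs : s ∈ I) :
    edgePoint i j s ∈ stdSimplex ℝ (Fin 4) :=
  convex_stdSimplex ℝ (Fin 4) (single_mem_stdSimplex ℝ i) (single_mem_stdSimplex ℝ j)
    (sub_nonneg.2 hs.2) hs.1 (sub_add_cancel 1 s)

theorem edgePoint_apply_pos {s : ℝ} (hs : s ∈ Set.Ioo (0 : ℝ) 1) (h : f = i ∨ f = j) :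
    0 < edgePoint i j s f := by
  obtain ⟨h0, h1⟩ := hs
  rw [edgePoint_apply]
  rcases h with rfl | rfl <;> simp only [if_true] <;> split_ifs <;> linarith

/-- Positions `p i j` of interior points on the oriented edges `ij` of a tetrahedron, measured from
`i`.  The values `p i i = 1 / 2` correspond to no edge. -/
def IsPosition (p : Fin 4 → Fin 4 → ℝ) : Prop :=
  ∀ i j, 0 < p i j ∧ p i j + p j i = 1

namespace IsPosition

theorem pos (hp : IsPosition p) (i j : Fin 4) : 0 < p i j := (hp i j).1

theorem symm (hp : IsPosition p) (i j : Fin 4) : p j i = 1 - p i j :=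
  eq_sub_of_add_eq' (hp i j).2

theorem lt_one (hp : IsPosition p) (i j : Fin 4) : p i j < 1 := by
  linarith [hp.symm i j, hp.pos j i]

theorem mem_Ioo (hp : IsPosition p) (i j : Fin 4) : p i j ∈ Set.Ioo (0 : ℝ) 1 :=
  ⟨hp.pos i j, hp.lt_one i j⟩

theorem edgePoint_mem_stdSimplex (hp : IsPosition p) (i j : Fin 4) :
    edgePoint i j (p i j) ∈ stdSimplex ℝ (Fin 4) :=
  NormalSurfaces.edgePoint_mem_stdSimplex i j (Set.Ioo_subset_Icc_self (hp.mem_Ioo i j))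

theorem edgePoint_comm (hp : IsPosition p) (i j : Fin 4) :
    edgePoint i j (p i j) = edgePoint j i (p j i) := by
  rw [edgePoint_symm, hp.symm i j]

end IsPosition

/-- The disk of type `t` has a normal arc in face `f` that cuts off the vertex `i`. -/
def HasArc : DiskType → Fin 4 → Fin 4 → Prop
  | .tri a, f, i => i = a ∧ i ≠ f
  | .quad, f, i => i = (![1, 0, 3, 2] : Fin 4 → Fin 4) f

/-- The disk of type `t` has a corner on the edge `ij`. -/
def Crosses : DiskType → Fin 4 → Fin 4 → Prop
  | .tri a, i, j => i ≠ j ∧ (i = a ∨ j = a)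
  | .quad, i, j => ¬(i < 2 ↔ j < 2)

instance (t : DiskType) (f i : Fin 4) : Decidable (HasArc t f i) := by
  cases t <;> unfold HasArc <;> infer_instance

instance (t : DiskType) (i j : Fin 4) : Decidable (Crosses t i j) := by
  cases t <;> unfold Crosses <;> infer_instance

/-- Disk types as optional vertices, where the quadrilateral corresponds to `none`. -/
def diskTypeEquivOption : DiskType ≃ Option (Fin 4) where
  toFun
    | .tri i => some i
    | .quad => none
  invFun
    | some i => .tri i
    | none => .quad
  left_inv t := by cases t <;> rfl
  right_inv o := by cases o <;> rfl

instance : DecidableEq DiskType := diskTypeEquivOption.decidableEq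

instance : Fintype DiskType := .ofEquiv _ diskTypeEquivOption.symm

theorem sum_diskType {M : Type*} [AddCommMonoid M] (g : DiskType → M) :
    ∑ t, g t = g .quad + ∑ i, g (.tri i) := by
  rw [← diskTypeEquivOption.symm.sum_comp, Fintype.sum_option]
  rfl

theorem crosses_comm : Crosses t i j ↔ Crosses t j i := by
  revert t i j; decide

theorem Crosses.ne : Crosses t i j → i ≠ j := by
  revert t i j; decide

theorem crosses_iff_hasArc (hij : i ≠ j) (hi : f ≠ i) (hj : f ≠ j) :
    Crosses t i j ↔ HasArc t f i ∨ HasArc t f j := by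
  revert t f i j; decide

theorem HasArc.unique : HasArc t f i → HasArc t f j → i = j := by
  revert t f i j; decide

theorem HasArc.ne : HasArc t f i → i ≠ f := by
  revert t f i; decide

theorem HasArc.crosses : HasArc t f i → j ≠ i → j ≠ f → Crosses t i j := by
  revert t f i j; decide

/-- The corners of the quadrilateral with positions `p`, in the cyclic order of
`IsElementaryQuad`. -/
noncomputable def quadCorner (p : Fin 4 → Fin 4 → ℝ) : Fin 4 → Fin 4 → ℝ :=
  ![edgePoint 0 2 (p 0 2), edgePoint 1 2 (p 1 2), edgePoint 1 3 (p 1 3), edgePoint 0 3 (p 0 3)]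

/-- The elementary disk of type `t` with corners at the positions `p`. -/
noncomputable def disk : DiskType → (Fin 4 → Fin 4 → ℝ) → Set (Fin 4 → ℝ)
  | .tri i, p => convexHull ℝ {x | ∃ j, j ≠ i ∧ x = edgePoint i j (p i j)}
  | .quad, p => ⋃ k : Fin 4, convexHull ℝ
      {(1 / 4 : ℝ) • ∑ l, quadCorner p l, quadCorner p k, quadCorner p (k + 1)}

theorem IsElementaryDisk.exists_eq_disk {D : Set (Fin 4 → ℝ)} (h : IsElementaryDisk t D) :
    ∃ p, IsPosition p ∧ D = disk t p := by
  cases t with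
  | tri a =>
    obtain ⟨s, hs, rfl⟩ := h
    refine ⟨fun i j ↦ if i = j then 1 / 2 else if i = a then s j else if j = a then 1 - s i
      else 1 / 2, fun i j ↦ ?_, ?_⟩
    · have hi := hs i
      have hj := hs j
      simp only [Set.mem_Ioo] at hi hj
      grind
    · simp +contextual only [disk, eq_comm (a := a), if_true, if_false]
      grind
  | quad =>
    obtain ⟨s, p, b, hs, rfl, rfl, rfl⟩ := h
    refine ⟨![![1 / 2, 1 / 2, s 0, s 3], ![1 / 2, 1 / 2, s 1, s 2],
      ![1 - s 0, 1 - s 1, 1 / 2, 1 / 2], ![1 - s 3, 1 - s 2, 1 / 2, 1 / 2]], fun i j ↦ ?_, rfl⟩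
    have hs (k) : 0 < s k ∧ s k < 1 := hs k
    fin_cases i <;> fin_cases j <;> simp [hs] <;> norm_num

theorem isElementaryDisk_disk (hp : IsPosition p) (t : DiskType) :
    IsElementaryDisk t (disk t p) := by
  cases t with
  | tri a => exact ⟨p a, hp.mem_Ioo a, rfl⟩
  | quad =>
    refine ⟨![p 0 2, p 1 2, p 1 3, p 0 3], _, _, fun k ↦ ?_, rfl, rfl, rfl⟩
    fin_cases k <;> exact hp.mem_Ioo _ _

/-- The corners of the disk of type `t` with positions `p`. -/
def corners (t : DiskType) (p : Fin 4 → Fin 4 → ℝ) : Set (Fin 4 → ℝ) :=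
  {x | ∃ k l, Crosses t k l ∧ x = edgePoint k l (p k l)}

theorem quadCorner_mem_corners (p : Fin 4 → Fin 4 → ℝ) (k : Fin 4) :
    quadCorner p k ∈ corners .quad p := by
  fin_cases k
  exacts [⟨0, 2, by decide, rfl⟩, ⟨1, 2, by decide, rfl⟩, ⟨1, 3, by decide, rfl⟩,
    ⟨0, 3, by decide, rfl⟩]

theorem disk_subset_convexHull_corners (t : DiskType) (p : Fin 4 → Fin 4 → ℝ) :
    disk t p ⊆ convexHull ℝ (corners t p) := by
  cases t with
  | tri a =>
    refine convexHull_mono ?_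
    rintro x ⟨j, hj, rfl⟩
    exact ⟨a, j, ⟨hj.symm, Or.inl rfl⟩, rfl⟩
  | quad =>
    have hcorner (k) := subset_convexHull ℝ _ (quadCorner_mem_corners p k)
    refine Set.iUnion_subset fun k ↦ convexHull_min ?_ (convex_convexHull ℝ _)
    refine Set.insert_subset ?_ (Set.pair_subset (hcorner k) (hcorner (k + 1)))
    rw [smul_sum]
    exact (convex_convexHull ℝ _).sum_mem (fun _ _ ↦ by norm_num) (by norm_num)
      fun k _ ↦ hcorner k

theorem disk_subset_stdSimplex (hp : IsPosition p) (t : DiskType) :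
    disk t p ⊆ stdSimplex ℝ (Fin 4) := by
  refine (disk_subset_convexHull_corners t p).trans (convexHull_min ?_ (convex_stdSimplex ℝ _))
  rintro x ⟨k, l, -, rfl⟩
  exact hp.edgePoint_mem_stdSimplex k l

/-- The linear function that is `1` on the plane through the points at positions `p i j` on the
edges at the vertex `i`, and `0` at this vertex. -/
noncomputable def cut (p : Fin 4 → Fin 4 → ℝ) (i : Fin 4) : (Fin 4 → ℝ) →ₗ[ℝ] ℝ :=
  ∑ l ∈ univ.erase i, (p i l)⁻¹ • LinearMap.proj l

theorem cut_apply (p : Fin 4 → Fin 4 → ℝ) (i : Fin 4) (x : Fin 4 → ℝ) :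
    cut p i x = ∑ l ∈ univ.erase i, (p i l)⁻¹ * x l := by
  simp [cut]

theorem cut_edgePoint (p : Fin 4 → Fin 4 → ℝ) (hij : j ≠ i) (s : ℝ) :
    cut p i (edgePoint i j s) = s / p i j := by
  rw [cut_apply, sum_eq_single j]
  · simp [edgePoint_apply, hij, div_eq_inv_mul]
  · intro b hb hbj
    simp [edgePoint_apply, hbj, ne_of_mem_erase hb]
  · simp [hij]

theorem cut_edgePoint_self (hp : IsPosition p) (hij : j ≠ i) :
    cut p i (edgePoint i j (p i j)) = 1 := by
  rw [cut_edgePoint p hij, div_self (hp.pos i j).ne']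

theorem one_lt_cut (hp : IsPosition p) (hx : x ∈ stdSimplex ℝ (Fin 4)) (hi : x i = 0) :
    1 < cut p i x := by
  have hsum : ∑ l ∈ univ.erase i, x l = 1 := by
    rw [sum_erase _ hi, hx.2]
  have hinv (l) : 1 < (p i l)⁻¹ := (one_lt_inv₀ (hp.pos i l)).2 (hp.lt_one i l)
  obtain ⟨l, hl, hxl⟩ := exists_ne_zero_of_sum_ne_zero (hsum.trans_ne one_ne_zero)
  rw [cut_apply, ← hsum]
  exact sum_lt_sum (fun l _ ↦ le_mul_of_one_le_left (hx.1 l) (hinv l).le)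
    ⟨l, hl, lt_mul_of_one_lt_left ((hx.1 l).lt_of_ne' hxl) (hinv l)⟩

theorem sum_smul_edgePoint (hp : IsPosition p) (hx : ∑ l, x l = 1) (h : cut p i x = 1) :
    ∑ l ∈ univ.erase i, ((p i l)⁻¹ * x l) • edgePoint i l (p i l) = x := by
  have hterm (l) : ((p i l)⁻¹ * x l) • edgePoint i l (p i l) =
      ((p i l)⁻¹ * x l - x l) • Pi.single i (1 : ℝ) + x l • Pi.single l (1 : ℝ) := by
    have := (hp.pos i l).ne'
    rw [edgePoint]
    match_scalars <;> field_simp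
  have hxi : 1 - ∑ l ∈ univ.erase i, x l = x i := by
    rw [← hx, ← add_sum_erase univ x (mem_univ i), add_sub_cancel_right]
  rw [sum_congr rfl fun l _ ↦ hterm l, sum_add_distrib, ← sum_smul, sum_sub_distrib, ← cut_apply, h,
    hxi, add_sum_erase univ (fun l ↦ x l • Pi.single l (1 : ℝ)) (mem_univ i)]
  simp only [← Pi.single_smul, smul_eq_mul, mul_one, univ_sum_single]

theorem mem_of_cut_eq_one {C : Set (Fin 4 → ℝ)} (hp : IsPosition p)
    (hx : x ∈ stdSimplex ℝ (Fin 4)) (h : cut p i x = 1) (hC : Convex ℝ C)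
    (hmem : ∀ l, l ≠ i → x l ≠ 0 → edgePoint i l (p i l) ∈ C) : x ∈ C := by
  rw [← sum_smul_edgePoint hp hx.2 h, ← sum_filter_of_ne (p := fun l ↦ x l ≠ 0)
    fun l _ hl hxl ↦ hl (by rw [hxl, mul_zero, zero_smul])]
  refine hC.sum_mem (fun l _ ↦ mul_nonneg (inv_nonneg.2 (hp.pos i l).le) (hx.1 l)) ?_ ?_
  · rw [sum_filter_of_ne fun l _ hl ↦ right_ne_zero_of_mul hl, ← cut_apply, h]
  · intro l hl
    rw [mem_filter, mem_erase] at hl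
    exact hmem l hl.1.1 hl.2

theorem mem_disk_tri (hp : IsPosition p) :
    x ∈ disk (.tri i) p ↔ x ∈ stdSimplex ℝ (Fin 4) ∧ cut p i x = 1 := by
  constructor
  · refine fun hx ↦ ⟨disk_subset_stdSimplex hp _ hx, ?_⟩
    refine convexHull_min (t := {x | cut p i x = 1}) ?_ (convex_hyperplane (cut p i).isLinear 1) hx
    rintro _ ⟨j, hj, rfl⟩
    exact cut_edgePoint_self hp hj
  · rintro ⟨hx, h⟩
    exact mem_of_cut_eq_one hp hx h (convex_convexHull ℝ _)
      fun l hl _ ↦ subset_convexHull ℝ _ ⟨l, hl, rfl⟩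

theorem convex_nonneg_and_eq_one_of_eq_zero {E : Type*} [AddCommGroup E] [Module ℝ E]
    (φ ψ : E →ₗ[ℝ] ℝ) : Convex ℝ {y | 0 ≤ φ y ∧ (φ y = 0 → ψ y = 1)} := by
  rintro y ⟨hy, hy'⟩ z ⟨hz, hz'⟩ a b ha hb hab
  simp only [Set.mem_ofPred_eq, map_add, map_smul, smul_eq_mul]
  have hay := mul_nonneg ha hy
  have hbz := mul_nonneg hb hz
  refine ⟨add_nonneg hay hbz, fun h ↦ ?_⟩
  obtain ⟨ha0, hb0⟩ := (add_eq_zero_iff_of_nonneg hay hbz).1 h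
  have hψy : a * ψ y = a := by
    rcases mul_eq_zero.1 ha0 with rfl | h0 <;> simp [*]
  have hψz : b * ψ z = b := by
    rcases mul_eq_zero.1 hb0 with rfl | h0 <;> simp [*]
  rw [hψy, hψz, hab]

theorem exists_cut_eq_one (hp : IsPosition p) (hx : x ∈ disk t p) (hf : x f = 0) :
    ∃ i, HasArc t f i ∧ cut p i x = 1 := by
  cases t with
  | tri a =>
    have h := ((mem_disk_tri hp).1 hx).2
    refine ⟨a, ⟨rfl, ?_⟩, h⟩
    rintro rfl
    exact (one_lt_cut hp (disk_subset_stdSimplex hp _ hx) hf).ne' h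
  | quad =>
    refine ⟨_, rfl, (convexHull_min ?_ (convex_nonneg_and_eq_one_of_eq_zero
      (LinearMap.proj f) (cut p _)) (disk_subset_convexHull_corners _ _ hx)).2 hf⟩
    rintro _ ⟨k, l, hkl, rfl⟩
    refine ⟨(hp.edgePoint_mem_stdSimplex k l).1 f, fun h ↦ ?_⟩
    have hfkl : ¬(f = k ∨ f = l) := fun hfkl ↦ (edgePoint_apply_pos (hp.mem_Ioo k l) hfkl).ne' h
    obtain ⟨hk, hl⟩ := not_or.1 hfkl
    rcases (crosses_iff_hasArc hkl.ne hk hl).1 hkl with harc | harc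
    · rw [← harc, cut_edgePoint_self hp hkl.ne.symm]
    · rw [← harc, hp.edgePoint_comm, cut_edgePoint_self hp hkl.ne]

theorem HasArc.exists_quadCorner (hp : IsPosition p) (h : HasArc .quad f i) :
    ∃ k, ∀ l, l ≠ i → l ≠ f →
      edgePoint i l (p i l) ∈ ({quadCorner p k, quadCorner p (k + 1)} : Set (Fin 4 → ℝ)) := by
  obtain rfl := h
  refine ⟨![1, 3, 2, 0] f, fun l hi hf ↦ ?_⟩
  fin_cases f <;> fin_cases l <;>
    simp [quadCorner, hp.edgePoint_comm 2, hp.edgePoint_comm 3] at hi hf ⊢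

theorem mem_disk_face_iff (hp : IsPosition p) (t : DiskType) (hx : x ∈ stdSimplex ℝ (Fin 4))
    (hf : x f = 0) : x ∈ disk t p ↔ ∃ i, HasArc t f i ∧ cut p i x = 1 := by
  refine ⟨fun h ↦ exists_cut_eq_one hp h hf, ?_⟩
  rintro ⟨i, hi, h⟩
  cases t with
  | tri a =>
    obtain ⟨rfl, -⟩ := hi
    exact (mem_disk_tri hp).2 ⟨hx, h⟩
  | quad =>
    obtain ⟨k, hk⟩ := hi.exists_quadCorner hp
    refine Set.mem_iUnion_of_mem k (mem_of_cut_eq_one hp hx h (convex_convexHull ℝ _) ?_)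
    intro l hl hxl
    exact subset_convexHull ℝ _ (Set.mem_insert_of_mem _ (hk l hl fun h ↦ hxl (h ▸ hf)))

end Disk

/-! ### Disjoint disks -/

section Disjoint

variable {p q : Fin 4 → Fin 4 → ℝ} {t t' : DiskType} {f i j k : Fin 4} {x : Fin 4 → ℝ}

theorem edgePoint_apply_of_ne (hi : f ≠ i) (hj : f ≠ j) (s : ℝ) : edgePoint i j s f = 0 := by
  rw [edgePoint_apply, if_neg hi, if_neg hj, mul_zero, mul_zero, add_zero]

theorem cut_edgePoint_right (hp : IsPosition p) (hij : i ≠ j) (s : ℝ) :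
    cut p j (edgePoint i j s) = (1 - s) / (1 - p i j) := by
  rw [edgePoint_symm, cut_edgePoint p hij, hp.symm i j]

theorem one_lt_cut_corner (hp : IsPosition p) (hq : IsPosition q)
    (h : ∀ j, Crosses t i j → p i j < q i j) (hx : x ∈ corners t q) : 1 < cut p i x := by
  have hedge (j) (hj : Crosses t i j) : 1 < cut p i (edgePoint i j (q i j)) := by
    rw [cut_edgePoint p hj.ne.symm, one_lt_div (hp.pos i j)]
    exact h j hj
  obtain ⟨k, l, hkl, rfl⟩ := hx
  by_cases hk : i = k
  · subst hk
    exact hedge l hkl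
  by_cases hl : i = l
  · subst hl
    rw [hq.edgePoint_comm]
    exact hedge k (crosses_comm.1 hkl)
  · exact one_lt_cut hp (hq.edgePoint_mem_stdSimplex k l) (edgePoint_apply_of_ne hk hl _)

theorem disjoint_disk_tri (hp : IsPosition p) (hq : IsPosition q)
    (h : ∀ j, Crosses t i j → p i j < q i j) : Disjoint (disk (.tri i) p) (disk t q) := by
  have hsub : disk t q ⊆ {x | 1 < cut p i x} :=
    (disk_subset_convexHull_corners t q).trans (convexHull_min
      (fun _ ↦ one_lt_cut_corner hp hq h) (convex_halfSpace_gt (cut p i).isLinear 1))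
  rw [Set.disjoint_left]
  intro x hx hx'
  exact (hsub hx').ne' ((mem_disk_tri hp).1 hx).2

/-- The tropical equation expresses that, up to a common value, only two adjacent weights are
nonzero. -/
theorem exists_weights_of_mem_disk_quad (hx : x ∈ disk .quad p) :
    ∃ w : Fin 4 → ℝ, (∀ k, 0 ≤ w k) ∧ ∑ k, w k = 1 ∧ min (w 0) (w 2) = min (w 1) (w 3) ∧
      ∑ k, w k • quadCorner p k = x := by
  obtain ⟨k, hk⟩ := Set.mem_iUnion.1 hx
  rw [convexHull_insert (Set.insert_nonempty _ _), convexHull_pair,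
    convexJoin_singleton_left, Set.mem_iUnion₂] at hk
  obtain ⟨_, ⟨β, γ, hβ, hγ, hβγ, rfl⟩, α, δ, hα, hδ, hαδ, rfl⟩ := hk
  have hδβ := mul_nonneg hδ hβ
  have hδγ := mul_nonneg hδ hγ
  refine ⟨(fun _ ↦ α / 4) + Pi.single k (δ * β) + Pi.single (k + 1) (δ * γ), fun l ↦ ?_, ?_, ?_,
    ?_⟩
  · simp only [Pi.add_apply, Pi.single_apply]
    split_ifs <;> linarith
  · simp only [Pi.add_apply, sum_add_distrib, sum_const, card_univ, Fintype.card_fin,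
      sum_pi_single', mem_univ, if_true]
    linear_combination hαδ + δ * hβγ
  · fin_cases k <;> simp [hδβ, hδγ]
  · simp only [Pi.add_apply, add_smul, sum_add_distrib, ← smul_sum, Pi.single_apply, ite_smul,
      zero_smul, sum_ite_eq', mem_univ, if_true]
    module

theorem lt_or_lt_or_eq_zero {a b a' b' r s r' s' : ℝ} (ha : 0 ≤ a) (hb : 0 ≤ b) (ha' : 0 ≤ a')
    (hb' : 0 ≤ b') (hr : 0 < r') (hs : 0 < s') (hrr : r' < r) (hss : s' < s)
    (h : a * r + b * s = a' * r' + b' * s') :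
    (a < a' ∨ b < b') ∨ (a = 0 ∧ b = 0 ∧ a' = 0 ∧ b' = 0) := by
  by_contra! hcon
  obtain ⟨⟨haa, hbb⟩, hne⟩ := hcon
  have ha0 : a = 0 := by nlinarith
  have hb0 : b = 0 := by nlinarith
  exact hne ha0 hb0 (le_antisymm (ha0 ▸ haa) ha') (le_antisymm (hb0 ▸ hbb) hb')

theorem disjoint_disk_quad (hp : IsPosition p) (hq : IsPosition q)
    (h : ∀ i j, i < 2 → 2 ≤ j → p i j < q i j) : Disjoint (disk .quad p) (disk .quad q) := by
  rw [Set.disjoint_left]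
  intro x hx hx'
  obtain ⟨w, hw, hw1, hmin, rfl⟩ := exists_weights_of_mem_disk_quad hx
  obtain ⟨w', hw', -, hmin', heq⟩ := exists_weights_of_mem_disk_quad hx'
  rw [Fin.sum_univ_four] at hw1
  have hlt (i j) (hi : i < 2 := by decide) (hj : 2 ≤ j := by decide) : p i j < q i j := h i j hi hj
  have hlt' (i j) (hi : i < 2 := by decide) (hj : 2 ≤ j := by decide) : 1 - q i j < 1 - p i j :=
    sub_lt_sub_left (hlt i j hi hj) 1
  have hq' (i j) : 0 < 1 - q i j := sub_pos.2 (hq.lt_one i j)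
  have hcoord (l) := congrFun heq l
  simp only [Finset.sum_apply, Pi.smul_apply, smul_eq_mul, Fin.sum_univ_four, quadCorner,
    Matrix.cons_val, edgePoint_apply] at hcoord
  have h0 := lt_or_lt_or_eq_zero (hw 0) (hw 3) (hw' 0) (hw' 3) (hq' 0 2) (hq' 0 3) (hlt' 0 2)
    (hlt' 0 3) (by simpa using (hcoord 0).symm)
  have h1 := lt_or_lt_or_eq_zero (hw 1) (hw 2) (hw' 1) (hw' 2) (hq' 1 2) (hq' 1 3) (hlt' 1 2)
    (hlt' 1 3) (by simpa using (hcoord 1).symm)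
  have h2 := lt_or_lt_or_eq_zero (hw' 0) (hw' 1) (hw 0) (hw 1) (hp.pos 0 2) (hp.pos 1 2) (hlt 0 2)
    (hlt 1 2) (by simpa using hcoord 2)
  have h3 := lt_or_lt_or_eq_zero (hw' 2) (hw' 3) (hw 2) (hw 3) (hp.pos 1 3) (hp.pos 0 3) (hlt 1 3)
    (hlt 0 3) (by simpa using hcoord 3)
  obtain ⟨h0, h2, h1, h3⟩ | ⟨h0, h2, h1, h3⟩ :
      (w 0 < w' 0 ∧ w 2 < w' 2 ∧ w' 1 < w 1 ∧ w' 3 < w 3) ∨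
        (w' 0 < w 0 ∧ w' 2 < w 2 ∧ w 1 < w' 1 ∧ w 3 < w' 3) := by grind
  all_goals linarith [min_lt_min h0 h2, min_lt_min h1 h3]

theorem exists_ne_ne_ne (i j f : Fin 4) : ∃ k, k ≠ i ∧ k ≠ j ∧ k ≠ f := by
  revert i j f; decide

theorem edgePoint_mem_disk_iff (hp : IsPosition p) (t : DiskType) (hij : i ≠ j) {s : ℝ}
    (hs : s ∈ I) : edgePoint i j s ∈ disk t p ↔ Crosses t i j ∧ s = p i j := by
  obtain ⟨f, hfi, hfj, -⟩ := exists_ne_ne_ne i j j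
  have hx := edgePoint_mem_stdSimplex i j hs
  have hleft : cut p i (edgePoint i j s) = 1 ↔ s = p i j := by
    rw [cut_edgePoint p hij.symm, div_eq_one_iff_eq (hp.pos i j).ne']
  have hright : cut p j (edgePoint i j s) = 1 ↔ s = p i j := by
    rw [cut_edgePoint_right hp hij, div_eq_one_iff_eq (sub_pos.2 (hp.lt_one i j)).ne',
      sub_right_inj]
  rw [mem_disk_face_iff hp t hx (edgePoint_apply_of_ne hfi hfj s), crosses_iff_hasArc hij hfi hfj]
  constructor
  · rintro ⟨k, hk, hcut⟩
    by_cases hki : k = i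
    · subst hki
      exact ⟨Or.inl hk, hleft.1 hcut⟩
    by_cases hkj : k = j
    · subst hkj
      exact ⟨Or.inr hk, hright.1 hcut⟩
    exact absurd hcut (one_lt_cut hp hx (edgePoint_apply_of_ne hki hkj s)).ne'
  · rintro ⟨h | h, hs⟩
    · exact ⟨i, h, hleft.2 hs⟩
    · exact ⟨j, h, hright.2 hs⟩

theorem segment_subset_face (hp : IsPosition p) (hif : i ≠ f) (hjf : j ≠ f) (hkf : k ≠ f) :
    segment ℝ (edgePoint i j (p i j)) (edgePoint i k (p i k)) ⊆
      {x | x ∈ stdSimplex ℝ (Fin 4) ∧ x f = 0} :=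
  ((convex_stdSimplex ℝ (Fin 4)).inter (convex_hyperplane
    (LinearMap.proj (R := ℝ) (φ := fun _ : Fin 4 ↦ ℝ) f).isLinear 0)).segment_subset
    ⟨hp.edgePoint_mem_stdSimplex i j, edgePoint_apply_of_ne hif.symm hjf.symm _⟩
    ⟨hp.edgePoint_mem_stdSimplex i k, edgePoint_apply_of_ne hif.symm hkf.symm _⟩

theorem HasArc.segment_subset_disk (h : HasArc t f i) (hp : IsPosition p) (hji : j ≠ i)
    (hjf : j ≠ f) (hki : k ≠ i) (hkf : k ≠ f) :
    segment ℝ (edgePoint i j (p i j)) (edgePoint i k (p i k)) ⊆ disk t p := by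
  intro x hx
  obtain ⟨hxs, hxf⟩ := segment_subset_face hp h.ne hjf hkf hx
  exact (mem_disk_face_iff hp t hxs hxf).2 ⟨i, h, (convex_hyperplane (cut p i).isLinear 1
    ).segment_subset (cut_edgePoint_self hp hji) (cut_edgePoint_self hp hki) hx⟩

theorem exists_mem_segment_eq {E : Type*} [AddCommGroup E] [Module ℝ E] (φ : E →ₗ[ℝ] ℝ) {a b : E}
    {c : ℝ} (ha : φ a ≤ c) (hb : c ≤ φ b) : ∃ z ∈ segment ℝ a b, φ z = c := by
  have hc : c ∈ segment ℝ (φ a) (φ b) := by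
    rw [segment_eq_Icc (ha.trans hb)]
    exact ⟨ha, hb⟩
  rwa [← φ.coe_toAffineMap, ← image_segment] at hc

/-- An arc of the first disk in face `f` has endpoints on both sides of the arc of the second disk
that cuts off `i'`, hence meets it. -/
theorem HasArc.not_disjoint {i' : Fin 4} (h : HasArc t f i) (h' : HasArc t' f i')
    (hp : IsPosition p) (hq : IsPosition q) (hji : j ≠ i) (hjf : j ≠ f) (hki : k ≠ i) (hkf : k ≠ f)
    (hj : cut q i' (edgePoint i j (p i j)) ≤ 1) (hk : 1 ≤ cut q i' (edgePoint i k (p i k))) :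
    ¬Disjoint (disk t p) (disk t' q) := by
  obtain ⟨z, hz, hcut⟩ := exists_mem_segment_eq _ hj hk
  obtain ⟨hzs, hzf⟩ := segment_subset_face hp h.ne hjf hkf hz
  exact Set.not_disjoint_iff.2 ⟨z, h.segment_subset_disk hp hji hjf hki hkf hz,
    (mem_disk_face_iff hq t' hzs hzf).2 ⟨i', h', hcut⟩⟩

theorem HasArc.position_lt_of_disjoint (h : HasArc t f i) (h' : HasArc t' f i)
    (hp : IsPosition p) (hq : IsPosition q) (hdisj : Disjoint (disk t p) (disk t' q)) (hji : j ≠ i)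
    (hjf : j ≠ f) (hki : k ≠ i) (hkf : k ≠ f) (hlt : p i j < q i j) : p i k < q i k := by
  by_contra! hle
  refine h.not_disjoint h' hp hq hji hjf hki hkf ?_ ?_ hdisj
  · rw [cut_edgePoint q hji, div_le_one (hq.pos i j)]
    exact hlt.le
  · rwa [cut_edgePoint q hki, one_le_div (hq.pos i k)]

theorem HasArc.position_lt_of_disjoint_of_ne (h : HasArc t f i) (h' : HasArc t' f j)
    (hp : IsPosition p) (hq : IsPosition q) (hdisj : Disjoint (disk t p) (disk t' q))
    (hij : i ≠ j) : p i j < q i j := by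
  by_contra! hle
  obtain ⟨k, hki, hkj, hkf⟩ := exists_ne_ne_ne i j f
  refine h.not_disjoint h' hp hq hij.symm h'.ne hki hkf ?_ ?_ hdisj
  · rw [cut_edgePoint_right hq hij, div_le_one (sub_pos.2 (hq.lt_one i j))]
    exact sub_le_sub_left hle 1
  · exact (one_lt_cut hq (hp.edgePoint_mem_stdSimplex i k)
      (edgePoint_apply_of_ne hij.symm hkj.symm _)).le

theorem exists_segment_subset_disk (hx : x ∈ disk t p) :
    ∃ i j, Crosses t i j ∧ segment ℝ x (edgePoint i j (p i j)) ⊆ disk t p := by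
  cases t with
  | tri i =>
    obtain ⟨j, hj, -⟩ := exists_ne_ne_ne i i i
    exact ⟨i, j, ⟨hj.symm, Or.inl rfl⟩, (convex_convexHull ℝ _).segment_subset hx
      (subset_convexHull ℝ _ ⟨j, hj, rfl⟩)⟩
  | quad =>
    obtain ⟨k, hk⟩ := Set.mem_iUnion.1 hx
    obtain ⟨i, j, hij, h⟩ := quadCorner_mem_corners p k
    refine ⟨i, j, hij, ?_⟩
    rw [← h]
    exact ((convex_convexHull ℝ _).segment_subset hk
      (subset_convexHull ℝ _ (by simp))).trans fun y hy ↦ Set.mem_iUnion_of_mem k hy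

end Disjoint

/-! ### Existence of a surface with given coordinates -/

/-- The disks that a surface with normal coordinates `c` has in one tetrahedron. -/
abbrev DiskIndex (c : DiskType → ℕ) : Type := (t : DiskType) × Fin (c t)

/-- The number of normal arcs in face `f` that cut off the vertex `i`. -/
def numArcs (c : DiskType → ℕ) (f i : Fin 4) : ℕ := ∑ t with HasArc t f i, c t

/-- The number of corners on the edge `ij`. -/
def weight (c : DiskType → ℕ) (i j : Fin 4) : ℕ := ∑ t with Crosses t i j, c t

theorem weight_comm (c : DiskType → ℕ) (i j : Fin 4) : weight c i j = weight c j i := by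
  simp only [weight, crosses_comm (i := i)]

section Tetrahedron

variable {c : DiskType → ℕ} {d e : DiskIndex c} {a f i j : Fin 4} {m : ℕ}

theorem weight_eq_add (c : DiskType → ℕ) (hij : i ≠ j) (hi : f ≠ i) (hj : f ≠ j) :
    weight c i j = numArcs c f i + numArcs c f j := by
  simp only [weight, numArcs, crosses_iff_hasArc hij hi hj]
  rw [filter_or, sum_union]
  exact disjoint_filter.2 fun t _ h h' ↦ hij (h.unique h')

theorem weight_eq (c : DiskType → ℕ) (hij : i ≠ j) :
    weight c i j = c (.tri i) + c (.tri j) + if Crosses .quad i j then c .quad else 0 := by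
  rw [weight, sum_filter, sum_diskType, Fin.sum_univ_four]
  fin_cases i <;> fin_cases j <;> simp [Crosses] at hij ⊢ <;> ring

theorem numArcs_eq (c : DiskType → ℕ) (hi : i ≠ f) :
    numArcs c f i = c (.tri i) + if HasArc .quad f i then c .quad else 0 := by
  rw [numArcs, sum_filter, sum_diskType, add_comm]
  simp [HasArc, hi]

/-- The number of corners on the edge `ij` between the vertex `i` and the disk `d`, if the triangles
and quadrilaterals are stacked in their order: the triangles at a vertex towards the center, and the
quadrilaterals from the edge `01` towards the edge `23`. -/
def rank (c : DiskType → ℕ) : DiskIndex c → Fin 4 → Fin 4 → ℕ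
  | ⟨.tri a, m⟩, i, j => if i = a then m else weight c i j - 1 - m
  | ⟨.quad, m⟩, i, _ => c (.tri i) + if i < 2 then (m : ℕ) else c .quad - 1 - m

theorem rank_add_rank (h : Crosses d.1 i j) :
    rank c d i j + rank c d j i + 1 = weight c i j := by
  have hw := weight_eq c h.ne
  obtain ⟨a | _, m⟩ := d
  · have hc := weight_comm c i j
    have hij := h.ne
    obtain ⟨-, rfl | rfl⟩ := h <;> simp only [rank, hij, hij.symm, if_true, if_false] <;> omega
  · rw [if_pos h] at hw
    simp only [Crosses] at h
    simp only [rank]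
    split_ifs <;> grind

/-- Evenly spaced positions of the corners of the disk `d`. -/
noncomputable def position (c : DiskType → ℕ) (d : DiskIndex c) (i j : Fin 4) : ℝ :=
  if Crosses d.1 i j then (rank c d i j + 1) / (weight c i j + 1) else 1 / 2

theorem isPosition_position (c : DiskType → ℕ) (d : DiskIndex c) : IsPosition (position c d) := by
  intro i j
  by_cases h : Crosses d.1 i j
  · rw [position, position, if_pos h, if_pos (crosses_comm.1 h), weight_comm c j i]
    refine ⟨by positivity, ?_⟩
    rw [← add_div, div_eq_one_iff_eq (by positivity), ← rank_add_rank h]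
    push_cast
    ring
  · rw [position, position, if_neg h, if_neg (mt crosses_comm.1 h)]
    norm_num

theorem position_lt (hd : Crosses d.1 i j) (he : Crosses e.1 i j)
    (h : rank c d i j < rank c e i j) : position c d i j < position c e i j := by
  rw [position, position, if_pos hd, if_pos he]
  gcongr

theorem tri_lt_rank {m : Fin (c (.tri a))} (h : ∀ k, e = ⟨.tri a, k⟩ → m < k)
    (hj : Crosses e.1 a j) : m < rank c e a j := by
  obtain ⟨b | _, k⟩ := e
  · by_cases hab : a = b
    · subst hab
      simpa [rank] using h k rfl
    · obtain ⟨-, rfl | rfl⟩ := hj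
      · exact absurd rfl hab
      · simp only [rank, if_neg hab, weight_eq c hab]
        omega
  · simp only [rank]
    omega

theorem disjoint_disk_position_tri {m : Fin (c (.tri a))} (h : ∀ k, e = ⟨.tri a, k⟩ → m < k) :
    Disjoint (disk (.tri a) (position c ⟨.tri a, m⟩)) (disk e.1 (position c e)) := by
  refine disjoint_disk_tri (isPosition_position _ _) (isPosition_position _ _) fun j hj ↦ ?_
  refine position_lt (show Crosses (.tri a) a j from ⟨hj.ne, Or.inl rfl⟩) hj ?_
  simpa only [rank, if_true] using tri_lt_rank h hj

theorem disjoint_disk_position_quad {m k : Fin (c .quad)} (h : m < k) :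
    Disjoint (disk .quad (position c ⟨.quad, m⟩)) (disk .quad (position c ⟨.quad, k⟩)) := by
  refine disjoint_disk_quad (isPosition_position _ _) (isPosition_position _ _) fun i j hi hj ↦ ?_
  have hij : Crosses .quad i j := by simp [Crosses, hi, hj]
  refine position_lt (d := ⟨.quad, m⟩) (e := ⟨.quad, k⟩) hij hij ?_
  simpa [rank, hi] using h

theorem disjoint_disk_position (hde : d ≠ e) :
    Disjoint (disk d.1 (position c d)) (disk e.1 (position c e)) := by
  obtain ⟨a | _, m⟩ := d <;> obtain ⟨b | _, k⟩ := e
  · by_cases h : ∃ l, (⟨.tri b, k⟩ : DiskIndex c) = ⟨.tri a, l⟩ ∧ l ≤ m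
    · obtain ⟨l, hl, hlm⟩ := h
      obtain ⟨rfl, rfl⟩ : b = a ∧ k ≍ l := by simpa using hl
      refine (disjoint_disk_position_tri fun l hl ↦ ?_).symm
      obtain rfl : m = l := by simpa using hl
      exact hlm.lt_of_ne' fun h ↦ hde (h ▸ rfl)
    · exact disjoint_disk_position_tri fun l hl ↦ not_le.1 fun hle ↦ h ⟨l, hl, hle⟩
  · exact disjoint_disk_position_tri (by simp)
  · exact (disjoint_disk_position_tri (by simp)).symm
  · rcases lt_trichotomy m k with h | rfl | h
    · exact disjoint_disk_position_quad h
    · exact absurd rfl hde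
    · exact (disjoint_disk_position_quad h).symm

theorem HasArc.exists_rank (h : HasArc d.1 f i) :
    ∃ m < numArcs c f i, ∀ l, rank c d i l = m := by
  rw [numArcs_eq c h.ne]
  obtain ⟨a | _, m⟩ := d
  · obtain ⟨rfl, -⟩ := h
    exact ⟨m, by omega, fun l ↦ if_pos rfl⟩
  · refine ⟨rank c ⟨.quad, m⟩ i i, ?_, fun l ↦ rfl⟩
    rw [if_pos h]
    simp only [rank]
    split_ifs <;> omega

theorem exists_hasArc_rank (hif : i ≠ f) (hm : m < numArcs c f i) :
    ∃ d : DiskIndex c, HasArc d.1 f i ∧ ∀ l, rank c d i l = m := by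
  rw [numArcs_eq c hif] at hm
  by_cases h : m < c (.tri i)
  · exact ⟨⟨.tri i, m, h⟩, ⟨rfl, hif⟩, fun l ↦ if_pos rfl⟩
  split_ifs at hm with hq
  · by_cases hi : i < 2
    · refine ⟨⟨.quad, m - c (.tri i), by omega⟩, hq, fun l ↦ ?_⟩
      simp only [rank, if_pos hi]
      omega
    · refine ⟨⟨.quad, c .quad - 1 - (m - c (.tri i)), by omega⟩, hq, fun l ↦ ?_⟩
      simp only [rank, if_neg hi]
      omega
  · omega

/-- The union of disjoint elementary disks with evenly spaced corners. -/
noncomputable def evenlySpacedDisks (c : DiskType → ℕ) : Set (Fin 4 → ℝ) :=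
  ⋃ d : DiskIndex c, disk d.1 (position c d)

theorem cut_position {x : Fin 4 → ℝ} (hf : x f = 0) (hi : HasArc d.1 f i)
    (hm : ∀ l, rank c d i l = m) :
    cut (position c d) i x = ∑ l ∈ univ.erase i, (weight c i l + 1) / (m + 1 : ℝ) * x l := by
  rw [cut_apply]
  refine sum_congr rfl fun l hl ↦ ?_
  by_cases hlf : l = f
  · rw [hlf, hf, mul_zero, mul_zero]
  · rw [position, if_pos (hi.crosses (ne_of_mem_erase hl) hlf), hm, inv_div]

theorem mem_evenlySpacedDisks_face_iff {x : Fin 4 → ℝ} (hx : x ∈ stdSimplex ℝ (Fin 4))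
    (hf : x f = 0) :
    x ∈ evenlySpacedDisks c ↔ ∃ i, i ≠ f ∧ ∃ m < numArcs c f i,
      ∑ l ∈ univ.erase i, (weight c i l + 1) / (m + 1 : ℝ) * x l = 1 := by
  have hface (d : DiskIndex c) := mem_disk_face_iff (isPosition_position c d) d.1 hx hf
  simp only [evenlySpacedDisks, Set.mem_iUnion, hface]
  constructor
  · rintro ⟨d, i, hi, hcut⟩
    obtain ⟨m, hm, hrank⟩ := hi.exists_rank
    exact ⟨i, hi.ne, m, hm, cut_position hf hi hrank ▸ hcut⟩
  · rintro ⟨i, hif, m, hm, hsum⟩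
    obtain ⟨d, hd, hrank⟩ := exists_hasArc_rank hif hm
    exact ⟨d, i, hd, (cut_position hf hd hrank).trans hsum⟩

end Tetrahedron

namespace FaceGluing

variable {n : ℕ} {𝒯 : FaceGluing n} {c : NormalCoord n} {T : Fin n} {f i j : Fin 4}
  {a b : Fin n × stdSimplex ℝ (Fin 4)}

theorem vert_injective (𝒯 : FaceGluing n) (T : Fin n) (f : Fin 4) :
    Function.Injective (𝒯.vert T f) :=
  Function.LeftInverse.injective (𝒯.vert_vert T f)

theorem Glued.symm (h : 𝒯.Glued a b) : 𝒯.Glued b a := by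
  obtain ⟨T, x⟩ := a
  obtain ⟨T', y⟩ := b
  obtain ⟨f, hf, rfl, hxy⟩ := h
  refine ⟨𝒯.vert T f f, (hxy f).trans hf, (𝒯.tet_tet T f).symm, fun i ↦ ?_⟩
  obtain ⟨k, rfl⟩ := Finite.surjective_of_injective (𝒯.vert_injective T f) i
  exact (congrArg x (𝒯.vert_vert T f k)).trans (hxy k).symm

/-- The matching equations: both sides of every face have the same numbers of normal arcs. -/
def Matching (𝒯 : FaceGluing n) (c : NormalCoord n) : Prop :=
  ∀ T f i, i ≠ f →
    numArcs (c T) f i = numArcs (c (𝒯.tet T f)) (𝒯.vert T f f) (𝒯.vert T f i)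

theorem Matching.weight_eq (h : 𝒯.Matching c) (hi : i ≠ f) (hj : j ≠ f) (hij : i ≠ j) :
    weight (c T) i j = weight (c (𝒯.tet T f)) (𝒯.vert T f i) (𝒯.vert T f j) := by
  have inj := 𝒯.vert_injective T f
  rw [weight_eq_add _ hij hi.symm hj.symm, weight_eq_add _ (inj.ne hij) (inj.ne hi.symm)
    (inj.ne hj.symm), h T f i hi, h T f j hj]

theorem Matching.sum_weight_mul_eq (h : 𝒯.Matching c) {x y : Fin 4 → ℝ} (hf : x f = 0)
    (hxy : ∀ i, y (𝒯.vert T f i) = x i) (hi : i ≠ f) (r : ℝ) :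
    ∑ l ∈ univ.erase i, (weight (c T) i l + 1) / r * x l = ∑ l ∈ univ.erase (𝒯.vert T f i),
      (weight (c (𝒯.tet T f)) (𝒯.vert T f i) l + 1) / r * y l := by
  have inj := 𝒯.vert_injective T f
  refine sum_equiv (.ofBijective _ (Finite.injective_iff_bijective.1 inj)) (by simp [inj.ne_iff])
    fun l hl ↦ ?_
  rw [Equiv.ofBijective_apply, hxy]
  by_cases hlf : l = f
  · rw [hlf, hf, mul_zero, mul_zero]
  · rw [h.weight_eq hi hlf (ne_of_mem_erase hl).symm]

theorem Matching.mem_evenlySpacedDisks_of_glued (h : 𝒯.Matching c) (hab : 𝒯.Glued a b)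
    (ha : ⇑a.2 ∈ evenlySpacedDisks (c a.1)) : ⇑b.2 ∈ evenlySpacedDisks (c b.1) := by
  obtain ⟨T, x⟩ := a
  obtain ⟨T', y⟩ := b
  obtain ⟨f, hf, rfl, hxy⟩ := hab
  obtain ⟨i, hi, m, hm, hsum⟩ := (mem_evenlySpacedDisks_face_iff x.2 hf).1 ha
  refine (mem_evenlySpacedDisks_face_iff y.2 ((hxy f).trans hf)).2
    ⟨_, (𝒯.vert_injective T f).ne hi, m, (h T f i hi).symm ▸ hm, ?_⟩
  exact (h.sum_weight_mul_eq hf hxy hi _).symm.trans hsum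

theorem Matching.exists_isNormalSurface (h : 𝒯.Matching c) : ∃ S, IsNormalSurface 𝒯 c S :=
  ⟨{y | Quot.lift (fun a : Fin n × stdSimplex ℝ (Fin 4) ↦ ⇑a.2 ∈ evenlySpacedDisks (c a.1))
    (fun _ _ hab ↦ propext ⟨h.mem_evenlySpacedDisks_of_glued hab,
      h.mem_evenlySpacedDisks_of_glued hab.symm⟩) y},
    fun T ↦ ⟨fun d ↦ disk d.1 (position (c T) d),
      fun d ↦ isElementaryDisk_disk (isPosition_position _ d) d.1,
      fun _ _ hde ↦ disjoint_disk_position hde, fun _ ↦ Set.mem_iUnion⟩⟩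

end FaceGluing

/-! ### Elements of a linear order by number -/

section Nth

variable {α β ι : Type*} [LinearOrder α] [LinearOrder β] {E : Set α} {s t : α} {m m' : ℕ}

/-- `s` is the `m`-th element of `E` in increasing order, counted from `0`; this is meant for finite
`E`, as `Set.ncard` is `0` on infinite sets. -/
def IsNth (E : Set α) (m : ℕ) (s : α) : Prop := s ∈ E ∧ (E ∩ Set.Iio s).ncard = m

theorem ncard_inter_Iio_lt (hE : E.Finite) (hs : s ∈ E) (h : s < t) :
    (E ∩ Set.Iio s).ncard < (E ∩ Set.Iio t).ncard :=
  Set.ncard_lt_ncard ⟨Set.inter_subset_inter_right _ (Set.Iio_subset_Iio h.le),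
    fun hsub ↦ lt_irrefl s (hsub ⟨hs, h⟩).2⟩ (hE.subset Set.inter_subset_left)

theorem IsNth.unique (hE : E.Finite) (hs : IsNth E m s) (ht : IsNth E m t) : s = t := by
  by_contra hne
  rcases lt_or_gt_of_ne hne with h | h
  · exact (ncard_inter_Iio_lt hE hs.1 h).ne (hs.2.trans ht.2.symm)
  · exact (ncard_inter_Iio_lt hE ht.1 h).ne (ht.2.trans hs.2.symm)

theorem exists_isNth (hE : E.Finite) (hm : m < E.ncard) : ∃ s, IsNth E m s := by
  let g := hE.toFinset.orderEmbOfFin (Set.ncard_eq_toFinset_card E hE).symm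
  have hg : Set.range g = E := by rw [range_orderEmbOfFin, hE.coe_toFinset]
  refine ⟨g ⟨m, hm⟩, hg.subset (Set.mem_range_self _), ?_⟩
  have himage : E ∩ Set.Iio (g ⟨m, hm⟩) = g '' Set.Iio ⟨m, hm⟩ := by
    have hbelow : g ⁻¹' Set.Iio (g ⟨m, hm⟩) = Set.Iio ⟨m, hm⟩ := Set.ext fun _ ↦ g.lt_iff_lt
    rw [← hbelow, Set.image_preimage_eq_range_inter, hg]
  rw [himage, Set.ncard_image_of_injective _ g.injective, ← coe_Iio, Set.ncard_coe_finset,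
    Fin.card_Iio]

theorem IsNth.lt_ncard (hE : E.Finite) (hs : IsNth E m s) : m < E.ncard := by
  rw [← hs.2]
  exact Set.ncard_lt_ncard ⟨Set.inter_subset_left, fun hsub ↦ lt_irrefl s (hsub hs.1).2⟩ hE

theorem ncard_inter_Iio_add_ncard_inter_Ioi (hE : E.Finite) (hs : s ∈ E) :
    (E ∩ Set.Iio s).ncard + (E ∩ Set.Ioi s).ncard + 1 = E.ncard := by
  rw [← Set.ncard_sdiff_singleton_add_one hs hE, Set.sdiff_eq, ← Set.Iio_union_Ioi,
    Set.inter_union_distrib_left, Set.ncard_union_eq ?_ (hE.subset Set.inter_subset_left)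
      (hE.subset Set.inter_subset_left)]
  exact (Set.disjoint_left.2 fun _ ↦ lt_asymm).mono Set.inter_subset_right Set.inter_subset_right

theorem IsNth.image_of_strictAnti {φ : α → β} (hφ : StrictAnti φ) (hE : E.Finite)
    (hs : IsNth E m s) (h : m + m' + 1 = E.ncard) : IsNth (φ '' E) m' (φ s) := by
  refine ⟨Set.mem_image_of_mem φ hs.1, ?_⟩
  have himage : φ '' E ∩ Set.Iio (φ s) = φ '' (E ∩ Set.Ioi s) := by
    have habove : φ ⁻¹' Set.Iio (φ s) = Set.Ioi s := Set.ext fun _ ↦ hφ.lt_iff_gt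
    rw [← habove, Set.image_inter_preimage]
  have hcount := ncard_inter_Iio_add_ncard_inter_Ioi hE hs.1
  rw [hs.2] at hcount
  rw [himage, Set.ncard_image_of_injective _ hφ.injective]
  omega

variable {A B : Set ι} {x : ι → α} {d : ι}

theorem IsNth.exists_eq_of_lt_ncard [Finite ι] (hx : Set.InjOn x A)
    (hAB : ∀ d ∈ A, ∀ e ∈ B, x d < x e) (hs : IsNth (x '' (A ∪ B)) m s) (hm : m < A.ncard) :
    ∃ d ∈ A, x d = s := by
  obtain ⟨⟨d, hd, rfl⟩, rfl⟩ := hs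
  refine ⟨d, hd.resolve_right fun hdB ↦ hm.not_ge ?_, rfl⟩
  rw [← hx.ncard_image]
  refine Set.ncard_le_ncard ?_ (Set.toFinite _)
  rintro _ ⟨e, he, rfl⟩
  exact ⟨⟨e, Or.inl he, rfl⟩, hAB e he d hdB⟩

theorem isNth_image_union_iff (hx : Set.InjOn x A) (hAB : ∀ d ∈ A, ∀ e ∈ B, x d < x e)
    (hd : d ∈ A) : IsNth (x '' (A ∪ B)) m (x d) ↔ {e ∈ A | x e < x d}.ncard = m := by
  have hbelow : x '' (A ∪ B) ∩ Set.Iio (x d) = x '' {e ∈ A | x e < x d} := by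
    ext s
    constructor
    · rintro ⟨⟨e, he, rfl⟩, h⟩
      exact ⟨e, ⟨he.resolve_right fun heB ↦ lt_asymm h (hAB d hd e heB), h⟩, rfl⟩
    · rintro ⟨e, ⟨he, h⟩, rfl⟩
      exact ⟨⟨e, Or.inl he, rfl⟩, h⟩
  rw [IsNth, hbelow, (hx.mono (Set.sep_subset _ _)).ncard_image]
  exact and_iff_right ⟨d, Or.inl hd, rfl⟩

end Nth

theorem ncard_setOf_diskIndex (c : DiskType → ℕ) (P : DiskType → Prop) [DecidablePred P] :
    {d : DiskIndex c | P d.1}.ncard = ∑ t with P t, c t := by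
  have hsigma : {d : DiskIndex c | P d.1} =
      ({t | P t} : Finset DiskType).sigma fun t ↦ (univ : Finset (Fin (c t))) := by
    ext d
    simp
  rw [hsigma, Set.ncard_coe_finset, card_sigma]
  simp only [card_univ, Fintype.card_fin]

/-! ### The points of a normal surface on the edges -/

section Edges

variable {n : ℕ} {𝒯 : FaceGluing n} {c : NormalCoord n} {S : Set 𝒯.Space} {T : Fin n}
  {f i j k l : Fin 4} {m m' : ℕ} {s : I}

/-- The oriented edges of the tetrahedra; `(T, i, j)` stands for the edge of the tetrahedron `T`
from the vertex `i` to the vertex `j`. -/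
abbrev OrientedEdge (n : ℕ) : Type := Fin n × Fin 4 × Fin 4

/-- The edge `ij` as a path in the standard tetrahedron. -/
noncomputable def stdEdge (i j : Fin 4) (s : I) : stdSimplex ℝ (Fin 4) :=
  ⟨edgePoint i j s, edgePoint_mem_stdSimplex i j s.2⟩

namespace FaceGluing

theorem continuous_charMap (𝒯 : FaceGluing n) (T : Fin n) : Continuous (𝒯.charMap T) :=
  continuous_quot_mk.comp (Continuous.prodMk_right T)

/-- The characteristic map of an oriented edge. -/
noncomputable def edgeMap (𝒯 : FaceGluing n) (e : OrientedEdge n) (s : I) : 𝒯.Space :=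
  𝒯.charMap e.1 (stdEdge e.2.1 e.2.2 s)

theorem edgeMap_swap (𝒯 : FaceGluing n) (T : Fin n) (i j : Fin 4) :
    𝒯.edgeMap (T, j, i) = 𝒯.edgeMap (T, i, j) ∘ σ :=
  funext fun s ↦ congrArg (𝒯.charMap T) (Subtype.ext (edgePoint_symm j i s))

theorem edgeMap_glue (𝒯 : FaceGluing n) (T : Fin n) (hi : i ≠ f) (hj : j ≠ f) :
    𝒯.edgeMap (𝒯.tet T f, 𝒯.vert T f i, 𝒯.vert T f j) = 𝒯.edgeMap (T, i, j) := by
  refine funext fun s ↦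
    (Quot.sound ⟨f, edgePoint_apply_of_ne hi.symm hj.symm s, rfl, fun l ↦ ?_⟩).symm
  change edgePoint _ _ (s : ℝ) _ = edgePoint i j s l
  simp only [edgePoint_apply, (𝒯.vert_injective T f).eq_iff]

end FaceGluing

/-- The point of `S` on the oriented edge `e` with `m` points of `S` before it (a junk value if
there is none). -/
noncomputable def edgeNth (S : Set 𝒯.Space) (e : OrientedEdge n) (m : ℕ) : 𝒯.Space :=
  𝒯.edgeMap e (Classical.epsilon (IsNth (𝒯.edgeMap e ⁻¹' S) m))

theorem edgeNth_eq {e : OrientedEdge n} (hfin : (𝒯.edgeMap e ⁻¹' S).Finite)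
    (hs : IsNth (𝒯.edgeMap e ⁻¹' S) m s) : edgeNth S e m = 𝒯.edgeMap e s := by
  rw [edgeNth, IsNth.unique hfin (Classical.epsilon_spec ⟨s, hs⟩) hs]

/-- A position as a parameter on the edge `ij`. -/
def IsPosition.toI {p : Fin 4 → Fin 4 → ℝ} (hp : IsPosition p) (i j : Fin 4) : I :=
  ⟨p i j, (hp.pos i j).le, (hp.lt_one i j).le⟩

/-- The disks with corner positions `p` make up the part of the surface `S` in the
tetrahedron `T`. -/
structure IsDiskSystem (S : Set 𝒯.Space) (T : Fin n)
    (p : DiskIndex (c T) → Fin 4 → Fin 4 → ℝ) : Prop where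
  isPosition : ∀ d, IsPosition (p d)
  disjoint : ∀ d e, d ≠ e → Disjoint (disk d.1 (p d)) (disk e.1 (p e))
  mem_iff : ∀ x : stdSimplex ℝ (Fin 4), 𝒯.charMap T x ∈ S ↔ ∃ d, x.1 ∈ disk d.1 (p d)

theorem IsNormalSurface.exists_isDiskSystem (hS : IsNormalSurface 𝒯 c S) (T : Fin n) :
    ∃ p : DiskIndex (c T) → Fin 4 → Fin 4 → ℝ, IsDiskSystem S T p := by
  obtain ⟨D, hD, hdisj, hmem⟩ := hS T
  choose p hp hDp using fun d ↦ (hD d).exists_eq_disk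
  obtain rfl : D = fun d ↦ disk d.1 (p d) := funext hDp
  exact ⟨p, hp, hdisj, hmem⟩

namespace IsDiskSystem

variable {p : DiskIndex (c T) → Fin 4 → Fin 4 → ℝ} {d e : DiskIndex (c T)}

theorem preimage_edgeMap (h : IsDiskSystem S T p) (hij : i ≠ j) :
    𝒯.edgeMap (T, i, j) ⁻¹' S = (fun d ↦ (h.isPosition d).toI i j) '' {d | Crosses d.1 i j} := by
  ext s
  refine (h.mem_iff _).trans (exists_congr fun d ↦ ?_)
  refine (edgePoint_mem_disk_iff (h.isPosition d) d.1 hij s.2).trans (and_congr_right fun _ ↦ ?_)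
  rw [eq_comm, Subtype.ext_iff]
  rfl

theorem injOn_toI (h : IsDiskSystem S T p) (hij : i ≠ j) :
    Set.InjOn (fun d ↦ (h.isPosition d).toI i j) {d | Crosses d.1 i j} := by
  intro d hd e he hde
  by_contra hne
  have hI : p d i j ∈ I := ((h.isPosition d).toI i j).2
  exact Set.disjoint_left.1 (h.disjoint d e hne)
    ((edgePoint_mem_disk_iff (h.isPosition d) d.1 hij hI).2 ⟨hd, rfl⟩)
    ((edgePoint_mem_disk_iff (h.isPosition e) e.1 hij hI).2 ⟨he, congrArg Subtype.val hde⟩)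

theorem finite_preimage_edgeMap (h : IsDiskSystem S T p) (hij : i ≠ j) :
    (𝒯.edgeMap (T, i, j) ⁻¹' S).Finite :=
  h.preimage_edgeMap hij ▸ Set.toFinite _

theorem joinedIn_charMap (h : IsDiskSystem S T p) {x y : stdSimplex ℝ (Fin 4)}
    (hseg : segment ℝ x.1 y.1 ⊆ disk d.1 (p d)) :
    JoinedIn S (𝒯.charMap T x) (𝒯.charMap T y) := by
  have himage : Subtype.val '' {z : stdSimplex ℝ (Fin 4) | z.1 ∈ disk d.1 (p d)} =
      disk d.1 (p d) :=
    (Subtype.image_preimage_val _ _).trans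
      (Set.inter_eq_right.2 (disk_subset_stdSimplex (h.isPosition d) d.1))
  have hjoin := JoinedIn.of_segment_subset hseg
  rw [← himage, Topology.IsInducing.subtypeVal.joinedIn_image (hseg (left_mem_segment ..))
    (hseg (right_mem_segment ..))] at hjoin
  exact (hjoin.map (𝒯.continuous_charMap T)).mono
    (Set.image_subset_iff.2 fun z hz ↦ (h.mem_iff z).2 ⟨d, hz⟩)

theorem toI_lt_of_hasArc (h : IsDiskSystem S T p) (hd : HasArc d.1 f i) (he : HasArc e.1 f l)
    (hli : l ≠ i) : (h.isPosition d).toI i l < (h.isPosition e).toI i l := by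
  have hde : d ≠ e := by
    rintro rfl
    exact hli (he.unique hd)
  exact hd.position_lt_of_disjoint_of_ne he (h.isPosition d) (h.isPosition e)
    (h.disjoint d e hde) hli.symm

theorem toI_lt_of_toI_lt (h : IsDiskSystem S T p) (hd : HasArc d.1 f i) (he : HasArc e.1 f i)
    (hji : j ≠ i) (hjf : j ≠ f) (hki : k ≠ i) (hkf : k ≠ f)
    (hlt : (h.isPosition d).toI i j < (h.isPosition e).toI i j) :
    (h.isPosition d).toI i k < (h.isPosition e).toI i k := by
  have hde : d ≠ e := by
    rintro rfl
    exact lt_irrefl _ hlt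
  exact hd.position_lt_of_disjoint he (h.isPosition d) (h.isPosition e) (h.disjoint d e hde)
    hji hjf hki hkf hlt

theorem preimage_edgeMap_of_face (h : IsDiskSystem S T p) (hif : i ≠ f) (hli : l ≠ i)
    (hlf : l ≠ f) :
    𝒯.edgeMap (T, i, l) ⁻¹' S = (fun d ↦ (h.isPosition d).toI i l) ''
      ({d | HasArc d.1 f i} ∪ {d | HasArc d.1 f l}) := by
  rw [h.preimage_edgeMap hli.symm]
  exact congrArg _ (Set.ext fun d ↦ crosses_iff_hasArc hli.symm hif.symm hlf.symm)

theorem injOn_toI_of_hasArc (h : IsDiskSystem S T p) (hli : l ≠ i) (hlf : l ≠ f) :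
    Set.InjOn (fun d ↦ (h.isPosition d).toI i l) {d | HasArc d.1 f i} :=
  (h.injOn_toI hli.symm).mono fun _ hd ↦ HasArc.crosses hd hli hlf

theorem exists_hasArc_toI_eq (h : IsDiskSystem S T p) (hif : i ≠ f) (hli : l ≠ i) (hlf : l ≠ f)
    (hs : IsNth (𝒯.edgeMap (T, i, l) ⁻¹' S) m s) (hm : m < numArcs (c T) f i) :
    ∃ d, HasArc d.1 f i ∧ (h.isPosition d).toI i l = s := by
  rw [h.preimage_edgeMap_of_face hif hli hlf] at hs
  rw [numArcs, ← ncard_setOf_diskIndex] at hm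
  exact hs.exists_eq_of_lt_ncard (h.injOn_toI_of_hasArc hli hlf)
    (fun d hd e he ↦ h.toI_lt_of_hasArc hd he hli) hm

theorem isNth_toI_iff (h : IsDiskSystem S T p) (hd : HasArc d.1 f i) (hli : l ≠ i) (hlf : l ≠ f) :
    IsNth (𝒯.edgeMap (T, i, l) ⁻¹' S) m ((h.isPosition d).toI i l) ↔
      {e | HasArc e.1 f i ∧ (h.isPosition e).toI i l < (h.isPosition d).toI i l}.ncard = m := by
  rw [h.preimage_edgeMap_of_face hd.ne hli hlf]
  exact isNth_image_union_iff (h.injOn_toI_of_hasArc hli hlf)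
    (fun d hd e he ↦ h.toI_lt_of_hasArc hd he hli) hd

theorem isNth_toI_of_isNth_toI (h : IsDiskSystem S T p) (hd : HasArc d.1 f i) (hji : j ≠ i)
    (hjf : j ≠ f) (hki : k ≠ i) (hkf : k ≠ f)
    (hnth : IsNth (𝒯.edgeMap (T, i, j) ⁻¹' S) m ((h.isPosition d).toI i j)) :
    IsNth (𝒯.edgeMap (T, i, k) ⁻¹' S) m ((h.isPosition d).toI i k) := by
  rw [h.isNth_toI_iff hd hki hkf, ← (h.isNth_toI_iff hd hji hjf).1 hnth]
  exact congrArg _ (Set.ext fun e ↦ and_congr_right fun he ↦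
    ⟨h.toI_lt_of_toI_lt he hd hki hkf hji hjf, h.toI_lt_of_toI_lt he hd hji hjf hki hkf⟩)

end IsDiskSystem

namespace IsNormalSurface

theorem finite_preimage_edgeMap (hS : IsNormalSurface 𝒯 c S) (T : Fin n) (hij : i ≠ j) :
    (𝒯.edgeMap (T, i, j) ⁻¹' S).Finite := by
  obtain ⟨p, h⟩ := hS.exists_isDiskSystem T
  exact h.finite_preimage_edgeMap hij

theorem ncard_preimage_edgeMap (hS : IsNormalSurface 𝒯 c S) (T : Fin n) (hij : i ≠ j) :
    (𝒯.edgeMap (T, i, j) ⁻¹' S).ncard = weight (c T) i j := by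
  obtain ⟨p, h⟩ := hS.exists_isDiskSystem T
  rw [h.preimage_edgeMap hij, (h.injOn_toI hij).ncard_image,
    ncard_setOf_diskIndex (c T) (Crosses · i j), weight]

theorem exists_isNth (hS : IsNormalSurface 𝒯 c S) (T : Fin n) (hij : i ≠ j)
    (hm : m < weight (c T) i j) : ∃ s, IsNth (𝒯.edgeMap (T, i, j) ⁻¹' S) m s :=
  NormalSurfaces.exists_isNth (hS.finite_preimage_edgeMap T hij)
    (by rwa [hS.ncard_preimage_edgeMap T hij])

theorem edgeNth_swap (hS : IsNormalSurface 𝒯 c S) (T : Fin n) (hij : i ≠ j)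
    (h : m + m' + 1 = weight (c T) i j) : edgeNth S (T, j, i) m' = edgeNth S (T, i, j) m := by
  have hfin := hS.finite_preimage_edgeMap T hij
  obtain ⟨s, hs⟩ := hS.exists_isNth T hij (m := m) (by omega)
  have hs' := hs.image_of_strictAnti strictAnti_symm hfin
    (h.trans (hS.ncard_preimage_edgeMap T hij).symm)
  rw [symm_involutive.image_eq_preimage_symm, ← Set.preimage_comp, ← 𝒯.edgeMap_swap] at hs'
  rw [edgeNth_eq hfin hs, edgeNth_eq (hS.finite_preimage_edgeMap T hij.symm) hs', 𝒯.edgeMap_swap,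
    Function.comp_apply, symm_symm]

theorem joinedIn_edgeNth (hS : IsNormalSurface 𝒯 c S) (T : Fin n) (hif : i ≠ f) (hji : j ≠ i)
    (hjf : j ≠ f) (hki : k ≠ i) (hkf : k ≠ f) (hm : m < numArcs (c T) f i) :
    JoinedIn S (edgeNth S (T, i, j) m) (edgeNth S (T, i, k) m) := by
  obtain ⟨p, h⟩ := hS.exists_isDiskSystem T
  have hw : m < weight (c T) i j := by
    rw [weight_eq_add _ hji.symm hif.symm hjf.symm]
    omega
  obtain ⟨s, hs⟩ := hS.exists_isNth T hji.symm hw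
  obtain ⟨d, hd, rfl⟩ := h.exists_hasArc_toI_eq hif hji hjf hs hm
  rw [edgeNth_eq (h.finite_preimage_edgeMap hji.symm) hs,
    edgeNth_eq (h.finite_preimage_edgeMap hki.symm)
      (h.isNth_toI_of_isNth_toI hd hji hjf hki hkf hs)]
  exact h.joinedIn_charMap (hd.segment_subset_disk (h.isPosition d) hji hjf hki hkf)

theorem exists_joinedIn_edgeNth (hS : IsNormalSurface 𝒯 c S) {y : 𝒯.Space} (hy : y ∈ S) :
    ∃ T i j m, i ≠ j ∧ m < weight (c T) i j ∧ JoinedIn S y (edgeNth S (T, i, j) m) := by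
  obtain ⟨⟨T, x⟩, rfl⟩ := Quot.exists_rep y
  obtain ⟨p, h⟩ := hS.exists_isDiskSystem T
  obtain ⟨d, hd⟩ := (h.mem_iff x).1 hy
  obtain ⟨i, j, hij, hseg⟩ := exists_segment_subset_disk hd
  have hfin := hS.finite_preimage_edgeMap T hij.ne
  obtain ⟨m, hnth⟩ : ∃ m, IsNth (𝒯.edgeMap (T, i, j) ⁻¹' S) m ((h.isPosition d).toI i j) := by
    refine ⟨_, ?_, rfl⟩
    rw [h.preimage_edgeMap hij.ne]
    exact ⟨d, hij, rfl⟩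
  refine ⟨T, i, j, m, hij.ne, hS.ncard_preimage_edgeMap T hij.ne ▸ hnth.lt_ncard hfin, ?_⟩
  rw [edgeNth_eq hfin hnth]
  exact h.joinedIn_charMap hseg

end IsNormalSurface

end Edges

/-! ### Reflections and translations of cyclically ordered points -/

section Integers

variable {R : ℤ → ℤ → Prop} {d N u v w : ℤ}

theorem rel_add_mul_of_rel_add (hR : Equivalence R) (h : ∀ x, R x (x + d)) (x z : ℤ) :
    R x (x + d * z) := by
  induction z using Int.induction_on with
  | zero => simpa using hR.refl x
  | succ k ih =>
    refine hR.trans ih ?_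
    convert h (x + d * k) using 1
    ring
  | pred k ih =>
    refine hR.trans ih (hR.symm ?_)
    convert h (x + d * (-(k : ℤ) - 1)) using 1
    ring

theorem rel_apply_of_forall_lt (hR : Equivalence R) (hN : 0 < N) (hper : ∀ x, R x (x + N))
    {φ : ℤ → ℤ} (hφ : ∀ x z, R (φ x) (φ (x + N * z))) (h : ∀ x, 0 ≤ x → x < N → R x (φ x))
    (x : ℤ) : R x (φ x) := by
  have hx := rel_add_mul_of_rel_add hR hper (x % N) (x / N)
  have hφx := hφ (x % N) (x / N)
  rw [Int.emod_add_mul_ediv] at hx hφx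
  exact hR.trans (hR.symm hx)
    (hR.trans (h _ (Int.emod_nonneg x hN.ne') (Int.emod_lt_of_pos x hN)) hφx)

/-- By Bézout's identity the two translations generate the translation by `2`, and the reflection
changes the parity. -/
theorem rel_of_translation_of_reflection (hR : Equivalence R) (huw : IsCoprime u w)
    (hper : ∀ x, R x (x + 2 * w)) (htrans : ∀ x, R x (x + 2 * u))
    (hrefl : ∀ x, R x (2 * u - 1 - x)) (x y : ℤ) : R x y := by
  obtain ⟨s, t, hst⟩ := huw
  have htwo (x : ℤ) : R x (x + 2) := by
    refine hR.trans (rel_add_mul_of_rel_add hR htrans x s) ?_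
    convert rel_add_mul_of_rel_add hR hper (x + 2 * u * s) t using 1
    linear_combination (-2 : ℤ) * hst
  have hone : R 0 1 := by
    refine hR.trans (hrefl 0) (hR.symm ?_)
    convert rel_add_mul_of_rel_add hR htwo 1 (u - 1) using 1
    ring
  have hzero (x : ℤ) : R 0 x := by
    obtain ⟨k, rfl | rfl⟩ := Int.even_or_odd' x
    · simpa using rel_add_mul_of_rel_add hR htwo 0 k
    · refine hR.trans hone ?_
      convert rel_add_mul_of_rel_add hR htwo 1 k using 1
      ring
  exact hR.trans (hR.symm (hzero x)) (hzero y)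

theorem rel_reflection (hR : Equivalence R) (hpos : 0 < u + v)
    (hper : ∀ x, R x (x + 2 * (u + v))) (hfst : ∀ x, 0 ≤ x → x < 2 * u → R x (2 * u - 1 - x))
    (hsnd : ∀ x, 2 * u ≤ x → x < 2 * (u + v) → R x (4 * u + 2 * v - 1 - x)) (x : ℤ) :
    R x (2 * u - 1 - x) := by
  refine rel_apply_of_forall_lt (φ := fun x ↦ 2 * u - 1 - x) hR (by omega) hper (fun x z ↦ ?_)
    (fun x hx hxN ↦ ?_) x
  · convert rel_add_mul_of_rel_add hR hper (2 * u - 1 - x) (-z) using 1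
    ring
  · by_cases hxu : x < 2 * u
    · exact hfst x hx hxu
    · refine hR.trans (hsnd x (not_lt.1 hxu) hxN) (hR.symm ?_)
      convert hper (2 * u - 1 - x) using 1
      ring

/-- The reflection conjugates the given half of the translation to the inverse of its other half. -/
theorem rel_translation (hR : Equivalence R) (hpos : 0 < u + v)
    (hper : ∀ x, R x (x + 2 * (u + v))) (hrefl : ∀ x, R x (2 * u - 1 - x))
    (hhalf : ∀ x, 0 ≤ x → x < u + v → R x (x + 2 * u)) (x : ℤ) : R x (x + 2 * u) := by
  have hperiod := rel_add_mul_of_rel_add hR hper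
  refine rel_apply_of_forall_lt (φ := (· + 2 * u)) hR (by omega) hper (fun x z ↦ ?_)
    (fun x hx hxN ↦ ?_) x
  · convert hperiod (x + 2 * u) z using 1
    ring
  · by_cases hxuv : x < u + v
    · exact hhalf x hx hxuv
    · set y := 2 * (u + v) - 1 - x with hy
      have hyx : R (y + 2 * u) x := by
        refine hR.trans (hrefl _) ?_
        convert hper (2 * u - 1 - (y + 2 * u)) using 1
        rw [hy]
        ring
      have hyx' : R y (x + 2 * u) := by
        refine hR.trans (hrefl y) ?_
        convert hper (2 * u - 1 - y) using 1
        rw [hy]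
        ring
      exact hR.trans (hR.symm hyx) (hR.trans (hR.symm (hhalf y (by omega) (by omega))) hyx')

theorem rel_of_reflections_of_translation (hR : Equivalence R) (huv : IsCoprime u v)
    (hpos : 0 < u + v) (hper : ∀ x, R x (x + 2 * (u + v)))
    (hfst : ∀ x, 0 ≤ x → x < 2 * u → R x (2 * u - 1 - x))
    (hsnd : ∀ x, 2 * u ≤ x → x < 2 * (u + v) → R x (4 * u + 2 * v - 1 - x))
    (hhalf : ∀ x, 0 ≤ x → x < u + v → R x (x + 2 * u)) (x y : ℤ) : R x y := by
  have hcop : IsCoprime u (u + v) := by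
    simpa [add_comm] using huv.add_mul_left_right 1
  have hrefl := rel_reflection hR hpos hper hfst hsnd
  exact rel_of_translation_of_reflection hR hcop hper (rel_translation hR hpos hper hrefl hhalf)
    hrefl x y

end Integers

section Cycle

theorem toNat_emod_eq {N k : ℕ} (hk : k < N) {x : ℤ} (z : ℤ) (hx : x = k + N * z) :
    (x % N).toNat = k := by
  rw [hx, Int.add_mul_emod_self_left, Int.emod_eq_of_lt (by positivity) (by exact_mod_cast hk),
    Int.toNat_natCast]

variable {X : Type*} {R : X → X → Prop} {a : ℕ → X} {u v : ℕ}

theorem rel_self_of_reflections (symm : ∀ {x y}, R x y → R y x)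
    (trans : ∀ {x y z}, R x y → R y z → R x z)
    (hfst : ∀ k l, k + l + 1 = 2 * u → R (a k) (a l))
    (hsnd : ∀ k l, k + l + 1 = 2 * v → R (a (2 * u + k)) (a (2 * u + l)))
    {k : ℕ} (hk : k < 2 * (u + v)) : R (a k) (a k) := by
  by_cases hku : k < 2 * u
  · have h := hfst k (2 * u - 1 - k) (by omega)
    exact trans h (symm h)
  · obtain ⟨m, rfl⟩ := Nat.exists_eq_add_of_le (not_lt.1 hku)
    have h := hsnd m (2 * v - 1 - m) (by omega)
    exact trans h (symm h)

theorem rel_of_reflections_of_cyclic_translation (symm : ∀ {x y}, R x y → R y x)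
    (trans : ∀ {x y z}, R x y → R y z → R x z) (huv : Nat.Coprime u v)
    (hfst : ∀ k l, k + l + 1 = 2 * u → R (a k) (a l))
    (hsnd : ∀ k l, k + l + 1 = 2 * v → R (a (2 * u + k)) (a (2 * u + l)))
    (hlow : ∀ k, k < u + v → k < 2 * v → R (a k) (a (k + 2 * u)))
    (hhigh : ∀ k, k + 2 * v < u + v → R (a (k + 2 * v)) (a k))
    {k l : ℕ} (hk : k < 2 * (u + v)) (hl : l < 2 * (u + v)) : R (a k) (a l) := by
  let ρ : ℤ → X := fun x ↦ a (x % (2 * (u + v) : ℕ)).toNat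
  have hρ {x : ℤ} (k : ℕ) (hk : k < 2 * (u + v)) (z : ℤ) (hx : x = k + (2 * (u + v) : ℕ) * z) :
      ρ x = a k := congrArg a (toNat_emod_eq hk z hx)
  have hlt (x : ℤ) : (x % (2 * (u + v) : ℕ)).toNat < 2 * (u + v) := by
    have := Int.emod_lt_of_pos x (b := (2 * (u + v) : ℕ)) (by omega)
    omega
  have hR : Equivalence fun x y ↦ R (ρ x) (ρ y) :=
    ⟨fun x ↦ rel_self_of_reflections (a := a) (R := R) symm trans hfst hsnd (hlt x), symm, trans⟩
  have hper (x : ℤ) : R (ρ x) (ρ (x + 2 * (u + v))) := by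
    have : ρ (x + 2 * (u + v)) = ρ x := by simp [ρ]
    exact this ▸ hR.refl x
  have hkl : R (ρ k) (ρ l) := by
    refine rel_of_reflections_of_translation hR (Nat.isCoprime_iff_coprime.2 huv) (by omega) hper
      (fun x hx hxu ↦ ?_) (fun x hxu hx ↦ ?_) (fun x hx hxuv ↦ ?_) k l
    · lift x to ℕ using hx
      rw [hρ x (by omega) 0 (by omega), hρ (2 * u - 1 - x) (by omega) 0 (by omega)]
      exact hfst _ _ (by omega)
    · obtain ⟨m, rfl⟩ := Int.le.dest hxu
      rw [hρ (2 * u + m) (by omega) 0 (by omega),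
        hρ (2 * u + (2 * v - 1 - m)) (by omega) 0 (by omega)]
      exact hsnd _ _ (by omega)
    · lift x to ℕ using hx
      rw [hρ x (by omega) 0 (by omega)]
      by_cases hxv : x < 2 * v
      · rw [hρ (x + 2 * u) (by omega) 0 (by omega)]
        exact hlow x (by omega) hxv
      · obtain ⟨m, rfl⟩ := Nat.exists_eq_add_of_le' (not_lt.1 hxv)
        rw [hρ m (by omega) 1 (by omega)]
        exact hhigh m (by omega)
  rwa [hρ k hk 0 (by omega), hρ l hl 0 (by omega)] at hkl

end Cycle

/-! ### The arcs of `uF + vG` -/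

section Arcs

/-- Representatives of the ten edges of `triangulationB`, numbered from `0` to `9`. -/
def edgeRep : Fin 10 → OrientedEdge 10 :=
  ![(0, 0, 1), (0, 0, 2), (0, 0, 3), (0, 1, 2), (0, 1, 3), (0, 2, 3), (1, 1, 2), (1, 1, 3),
    (3, 0, 2), (4, 1, 3)]

/-- The number of points in which `uF + vG` meets the edge represented by `edgeRep e`. -/
def numPoints (u v : ℕ) : Fin 10 → ℕ :=
  ![2 * u + 2 * v, 4 * u + 4 * v, 4 * u + 2 * v, 2 * u + 2 * v, 2 * u, 2 * v, 2 * u + 2 * v,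
    2 * u + 4 * v, 4 * u + 4 * v, 2 * u + 2 * v]

/-- The combinatorial pattern of some of the normal arcs of `uF + vG`: `x e m` stands for the point
number `m` on the edge represented by `edgeRep e`, `R` for being joined in the surface, and the
field `arcef` says which points of the edges `e` and `f` are joined by the arcs of one family. -/
structure IsArcSystem {X : Type*} (u v : ℕ) (R : X → X → Prop) (x : Fin 10 → ℕ → X) : Prop where
  symm : ∀ {y z}, R y z → R z y
  trans : ∀ {y z w}, R y z → R z w → R y w
  arc01 : ∀ m < 2 * u + 2 * v, R (x 0 m) (x 1 m)
  arc02 : ∀ m < 2 * u + 2 * v, R (x 0 m) (x 2 m)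
  arc04 : ∀ k l, k + l + 1 = 2 * u → R (x 0 k) (x 4 l)
  arc05 : ∀ m < 2 * v, R (x 0 (2 * u + m)) (x 5 m)
  arc12 : ∀ m < 4 * u + 2 * v, R (x 1 m) (x 2 m)
  arc12' : ∀ k l, k + l + 1 = 4 * u + 2 * v → k < 3 * u + v → R (x 1 k) (x 2 l)
  arc13 : ∀ m < 2 * u + 2 * v, R (x 1 (2 * u + 2 * v + m)) (x 3 m)
  arc34 : ∀ m < 2 * u, R (x 3 m) (x 4 m)
  arc53 : ∀ k l, k + l + 1 = 2 * u + 2 * v → k < 2 * v → R (x 5 k) (x 3 l)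
  arc73 : ∀ k l, k + l + 1 = 2 * u + 2 * v → R (x 7 k) (x 3 l)
  arc57 : ∀ k l, k + l + 1 = 2 * u + 4 * v → k < 2 * v → R (x 5 k) (x 7 l)
  arc77 : ∀ k l, k + l + 1 = 2 * u + 4 * v → k < u + 3 * v → R (x 7 k) (x 7 l)
  arc27 : ∀ m < u + v, R (x 2 m) (x 7 m)
  arc67 : ∀ m < 2 * u + 2 * v, R (x 6 m) (x 7 m)
  arc28 : ∀ m < 3 * u + 2 * v, R (x 2 m) (x 8 m)
  arc68 : ∀ k l, k + l + 1 = 4 * u + 4 * v → k < 2 * u + 2 * v → R (x 6 k) (x 8 l)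
  arc29 : ∀ k l, k + l + 1 = 2 * u + 2 * v → R (x 2 k) (x 9 l)

namespace IsArcSystem

variable {X : Type*} {u v : ℕ} {R : X → X → Prop} {x : Fin 10 → ℕ → X}

theorem rel_three_zero_fst (h : IsArcSystem u v R x) {k l : ℕ} (hkl : k + l + 1 = 2 * u) :
    R (x 3 k) (x 0 l) :=
  h.trans (h.arc34 k (by omega)) (h.symm (h.arc04 l k (by omega)))

theorem rel_three_zero_snd (h : IsArcSystem u v R x) {k l : ℕ} (hkl : k + l + 1 = 2 * v) :
    R (x 3 (2 * u + k)) (x 0 (2 * u + l)) :=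
  h.trans (h.symm (h.arc53 l (2 * u + k) (by omega) (by omega))) (h.symm (h.arc05 l (by omega)))

theorem rel_seven_zero_fst (h : IsArcSystem u v R x) {k : ℕ} (hk : k < 2 * v) :
    R (x 7 k) (x 0 (2 * u + k)) :=
  h.trans (h.arc73 k (2 * u + (2 * v - 1 - k)) (by omega)) (h.rel_three_zero_snd (by omega))

theorem rel_seven_zero_snd (h : IsArcSystem u v R x) {k : ℕ} (hk : k < 2 * u) :
    R (x 7 (2 * v + k)) (x 0 k) :=
  h.trans (h.arc73 (2 * v + k) (2 * u - 1 - k) (by omega)) (h.rel_three_zero_fst (by omega))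

theorem rel_zero_reflect_fst (h : IsArcSystem u v R x) (k l : ℕ) (hkl : k + l + 1 = 2 * u) :
    R (x 0 k) (x 0 l) := by
  wlog hk : k < u generalizing k l
  · exact h.symm (this l k (by omega) (by omega))
  exact h.trans (h.symm (h.rel_seven_zero_snd (by omega)))
    (h.trans (h.arc77 (2 * v + k) (2 * v + l) (by omega) (by omega))
      (h.rel_seven_zero_snd (by omega)))

theorem rel_zero_reflect_snd (h : IsArcSystem u v R x) (k l : ℕ) (hkl : k + l + 1 = 2 * v) :
    R (x 0 (2 * u + k)) (x 0 (2 * u + l)) := by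
  wlog hk : k < v generalizing k l
  · exact h.symm (this l k (by omega) (by omega))
  exact h.trans (h.arc01 (2 * u + k) (by omega))
    (h.trans (h.arc12' (2 * u + k) (2 * u + l) (by omega) (by omega))
      (h.symm (h.arc02 (2 * u + l) (by omega))))

theorem rel_zero_add (h : IsArcSystem u v R x) (k : ℕ) (hk : k < u + v) (hkv : k < 2 * v) :
    R (x 0 k) (x 0 (k + 2 * u)) := by
  rw [add_comm k]
  exact h.trans (h.arc02 k (by omega)) (h.trans (h.arc27 k hk) (h.rel_seven_zero_fst hkv))

theorem rel_zero_sub (h : IsArcSystem u v R x) (k : ℕ) (hk : k + 2 * v < u + v) :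
    R (x 0 (k + 2 * v)) (x 0 k) := by
  rw [add_comm k]
  exact h.trans (h.arc02 _ (by omega))
    (h.trans (h.arc27 _ (by omega)) (h.rel_seven_zero_snd (by omega)))

theorem rel_zero_zero (h : IsArcSystem u v R x) (huv : u.Coprime v) {m : ℕ}
    (hm : m < 2 * u + 2 * v) : R (x 0 0) (x 0 m) :=
  rel_of_reflections_of_cyclic_translation (R := R) (a := x 0) h.symm h.trans huv
    h.rel_zero_reflect_fst h.rel_zero_reflect_snd h.rel_zero_add h.rel_zero_sub (by omega)
    (by omega)

theorem rel_zero_three (h : IsArcSystem u v R x) (huv : u.Coprime v) {m : ℕ}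
    (hm : m < 2 * u + 2 * v) : R (x 0 0) (x 3 m) := by
  by_cases hmu : m < 2 * u
  · exact h.trans (h.rel_zero_zero huv (m := 2 * u - 1 - m) (by omega))
      (h.symm (h.rel_three_zero_fst (by omega)))
  · obtain ⟨k, rfl⟩ := Nat.exists_eq_add_of_le (not_lt.1 hmu)
    exact h.trans (h.rel_zero_zero huv (m := 2 * u + (2 * v - 1 - k)) (by omega))
      (h.symm (h.rel_three_zero_snd (by omega)))

theorem rel_zero_one (h : IsArcSystem u v R x) (huv : u.Coprime v) {m : ℕ}
    (hm : m < 4 * u + 4 * v) : R (x 0 0) (x 1 m) := by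
  by_cases hmuv : m < 2 * u + 2 * v
  · exact h.trans (h.rel_zero_zero huv hmuv) (h.arc01 m hmuv)
  · obtain ⟨k, rfl⟩ := Nat.exists_eq_add_of_le (not_lt.1 hmuv)
    exact h.trans (h.rel_zero_three huv (by omega)) (h.symm (h.arc13 k (by omega)))

theorem rel_zero_two (h : IsArcSystem u v R x) (huv : u.Coprime v) {m : ℕ}
    (hm : m < 4 * u + 2 * v) : R (x 0 0) (x 2 m) :=
  h.trans (h.rel_zero_one huv (by omega)) (h.arc12 m hm)

theorem rel_zero_seven (h : IsArcSystem u v R x) (huv : u.Coprime v) {m : ℕ}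
    (hm : m < 2 * u + 4 * v) : R (x 0 0) (x 7 m) := by
  by_cases hmuv : m < 2 * u + 2 * v
  · exact h.trans (h.rel_zero_three huv (m := 2 * u + 2 * v - 1 - m) (by omega))
      (h.symm (h.arc73 m _ (by omega)))
  · have hfive := h.arc05 (2 * u + 4 * v - 1 - m) (by omega)
    exact h.trans (h.rel_zero_zero huv (by omega))
      (h.trans hfive (h.arc57 _ m (by omega) (by omega)))

theorem rel_zero_six (h : IsArcSystem u v R x) (huv : u.Coprime v) {m : ℕ}
    (hm : m < 2 * u + 2 * v) : R (x 0 0) (x 6 m) :=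
  h.trans (h.rel_zero_seven huv (by omega)) (h.symm (h.arc67 m hm))

theorem rel_zero_eight (h : IsArcSystem u v R x) (huv : u.Coprime v) {m : ℕ}
    (hm : m < 4 * u + 4 * v) : R (x 0 0) (x 8 m) := by
  by_cases hmuv : m < 2 * u + 2 * v
  · exact h.trans (h.rel_zero_two huv (by omega)) (h.arc28 m (by omega))
  · exact h.trans (h.rel_zero_six huv (m := 4 * u + 4 * v - 1 - m) (by omega))
      (h.arc68 _ m (by omega) (by omega))

theorem rel_of_lt_numPoints (h : IsArcSystem u v R x) (huv : u.Coprime v) {e : Fin 10} {m : ℕ}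
    (hm : m < numPoints u v e) : R (x 0 0) (x e m) := by
  fin_cases e <;> dsimp [numPoints] at hm
  · exact h.rel_zero_zero huv hm
  · exact h.rel_zero_one huv hm
  · exact h.rel_zero_two huv hm
  · exact h.rel_zero_three huv hm
  · exact h.trans (h.rel_zero_zero huv (m := 2 * u - 1 - m) (by omega)) (h.arc04 _ m (by omega))
  · exact h.trans (h.rel_zero_zero huv (by omega)) (h.arc05 m hm)
  · exact h.rel_zero_six huv hm
  · exact h.rel_zero_seven huv hm
  · exact h.rel_zero_eight huv hm
  · exact h.trans (h.rel_zero_two huv (m := 2 * u + 2 * v - 1 - m) (by omega))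
      (h.arc29 _ m (by omega))

end IsArcSystem

end Arcs

section SameEdge

variable {n : ℕ}

/-- One step of the rotation around an edge of the triangulation: a state `(T, i, j, f, g)` consists
of the edge `ij` of the tetrahedron `T` and of the two faces `f` and `g` of `T` that contain it, and
the rotation crosses the face `f`. -/
def FaceGluing.rotate (𝒯 : FaceGluing n) :
    Fin n × Fin 4 × Fin 4 × Fin 4 × Fin 4 → Fin n × Fin 4 × Fin 4 × Fin 4 × Fin 4
  | (T, i, j, f, g) => (𝒯.tet T f, 𝒯.vert T f i, 𝒯.vert T f j, 𝒯.vert T f g, 𝒯.vert T f f)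

/-- The oriented edge in a state of the rotation around an edge. -/
def edgeOf : Fin n × Fin 4 × Fin 4 × Fin 4 × Fin 4 → OrientedEdge n
  | (T, i, j, _, _) => (T, i, j)

/-- The oriented edges `a` and `b` of tetrahedra are identified in the triangulation by a rotation
around `a`. To make this decidable, the rotation is limited to four steps. -/
def FaceGluing.SameEdge (𝒯 : FaceGluing n) (a b : OrientedEdge n) : Prop :=
  ∃ f g, f ≠ g ∧ (a.2.1 ≠ f ∧ a.2.2 ≠ f ∧ a.2.1 ≠ g ∧ a.2.2 ≠ g) ∧ ∃ k : Fin 5,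
    edgeOf (𝒯.rotate^[k] (a.1, a.2.1, a.2.2, f, g)) = b

instance (𝒯 : FaceGluing n) (a b : OrientedEdge n) : Decidable (𝒯.SameEdge a b) := by
  unfold FaceGluing.SameEdge
  infer_instance

/-- The same edge with the opposite orientation. -/
def OrientedEdge.reverse (e : OrientedEdge n) : OrientedEdge n :=
  (e.1, e.2.2, e.2.1)

variable {𝒯 : FaceGluing n} {c : NormalCoord n} {S : Set 𝒯.Space} {a b : OrientedEdge n}

theorem FaceGluing.edgeMap_eq_of_edgeOf_iterate_rotate_eq (k : ℕ) {T : Fin n} {i j f g : Fin 4}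
    (h : i ≠ f ∧ j ≠ f ∧ i ≠ g ∧ j ≠ g) (hk : edgeOf (𝒯.rotate^[k] (T, i, j, f, g)) = b) :
    𝒯.edgeMap (T, i, j) = 𝒯.edgeMap b := by
  induction k generalizing T i j f g with
  | zero => exact congrArg 𝒯.edgeMap hk
  | succ k ih =>
    obtain ⟨hif, hjf, hig, hjg⟩ := h
    have hinj := 𝒯.vert_injective T f
    rw [← 𝒯.edgeMap_glue T hif hjf]
    exact ih ⟨hinj.ne hig, hinj.ne hjg, hinj.ne hif, hinj.ne hjf⟩ hk

theorem FaceGluing.SameEdge.edgeMap_eq (h : 𝒯.SameEdge a b) : 𝒯.edgeMap a = 𝒯.edgeMap b := by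
  obtain ⟨f, g, -, hne, k, hk⟩ := h
  exact edgeMap_eq_of_edgeOf_iterate_rotate_eq k hne hk

theorem FaceGluing.SameEdge.edgeNth_eq (h : 𝒯.SameEdge a b) (S : Set 𝒯.Space) (m : ℕ) :
    edgeNth S a m = edgeNth S b m := by
  simp only [edgeNth, h.edgeMap_eq]

theorem IsNormalSurface.weight_eq_of_sameEdge (hS : IsNormalSurface 𝒯 c S) (h : 𝒯.SameEdge a b)
    (ha : a.2.1 ≠ a.2.2) (hb : b.2.1 ≠ b.2.2) :
    weight (c a.1) a.2.1 a.2.2 = weight (c b.1) b.2.1 b.2.2 := by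
  rw [← hS.ncard_preimage_edgeMap a.1 ha, ← hS.ncard_preimage_edgeMap b.1 hb]
  exact congrArg (fun p ↦ (p ⁻¹' S).ncard) h.edgeMap_eq

end SameEdge

section Sum

variable {n : ℕ}

theorem numArcs_smul_add_smul (c d : NormalCoord n) (u v : ℕ) (T : Fin n) (f i : Fin 4) :
    numArcs ((u • c + v • d) T) f i = u * numArcs (c T) f i + v * numArcs (d T) f i := by
  simp [numArcs, sum_add_distrib, mul_sum]

theorem weight_smul_add_smul (c d : NormalCoord n) (u v : ℕ) (T : Fin n) (i j : Fin 4) :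
    weight ((u • c + v • d) T) i j = u * weight (c T) i j + v * weight (d T) i j := by
  simp [weight, sum_add_distrib, mul_sum]

theorem FaceGluing.Matching.smul_add_smul {𝒯 : FaceGluing n} {c d : NormalCoord n}
    (hc : 𝒯.Matching c) (hd : 𝒯.Matching d) (u v : ℕ) : 𝒯.Matching (u • c + v • d) := by
  intro T f i hi
  rw [numArcs_smul_add_smul, numArcs_smul_add_smul, hc T f i hi, hd T f i hi]

end Sum

section Arcs

theorem matching_coordF : triangulationB.Matching coordF := by
  unfold FaceGluing.Matching
  decide

theorem matching_coordG : triangulationB.Matching coordG := by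
  unfold FaceGluing.Matching
  decide

theorem exists_sameEdge_edgeRep :
    ∀ (T : Fin 10) (i j : Fin 4), i ≠ j → ∃ e, triangulationB.SameEdge (edgeRep e) (T, i, j) ∨
      triangulationB.SameEdge (edgeRep e) (T, j, i) := by
  decide +kernel

theorem edgeRep_ne (e : Fin 10) : (edgeRep e).2.1 ≠ (edgeRep e).2.2 := by
  revert e
  decide

theorem numPoints_eq_add (u v : ℕ) (e : Fin 10) :
    numPoints u v e = u * numPoints 1 0 e + v * numPoints 0 1 e := by
  fin_cases e <;> simp [numPoints] <;> ring

theorem weight_coordF_edgeRep (e : Fin 10) :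
    weight (coordF (edgeRep e).1) (edgeRep e).2.1 (edgeRep e).2.2 = numPoints 1 0 e := by
  revert e
  decide

theorem weight_coordG_edgeRep (e : Fin 10) :
    weight (coordG (edgeRep e).1) (edgeRep e).2.1 (edgeRep e).2.2 = numPoints 0 1 e := by
  revert e
  decide

theorem weight_edgeRep (u v : ℕ) (e : Fin 10) :
    weight ((u • coordF + v • coordG) (edgeRep e).1) (edgeRep e).2.1 (edgeRep e).2.2 =
      numPoints u v e := by
  rw [weight_smul_add_smul, weight_coordF_edgeRep, weight_coordG_edgeRep, ← numPoints_eq_add]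

/-- Around the vertex `i` of the face `f` of the tetrahedron `T` there are `r` arcs of `F` and `s`
arcs of `G`, and they lead from the edge `ij` to the edge `ik`; these edges are identified with `a`
and `b`. -/
def IsArcFamily (T : Fin 10) (f i j k : Fin 4) (r s : ℕ) (a b : OrientedEdge 10) : Prop :=
  (i ≠ f ∧ j ≠ i ∧ j ≠ f ∧ k ≠ i ∧ k ≠ f) ∧ triangulationB.SameEdge a (T, i, j) ∧
    triangulationB.SameEdge b (T, i, k) ∧ numArcs (coordF T) f i = r ∧ numArcs (coordG T) f i = s

instance (T : Fin 10) (f i j k : Fin 4) (r s : ℕ) (a b : OrientedEdge 10) :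
    Decidable (IsArcFamily T f i j k r s a b) := by
  unfold IsArcFamily
  infer_instance

variable {u v : ℕ} {S : Set triangulationB.Space} {e e' : Fin 10}

theorem edgeNth_reverse_edgeRep
    (hS : IsNormalSurface triangulationB (u • coordF + v • coordG) S) {m m' : ℕ}
    (h : m + m' + 1 = numPoints u v e) :
    edgeNth S (edgeRep e).reverse m = edgeNth S (edgeRep e) m' :=
  hS.edgeNth_swap _ (edgeRep_ne e) (by rw [weight_edgeRep, ← h, add_comm m])

theorem joinedIn_of_isArcFamily
    (hS : IsNormalSurface triangulationB (u • coordF + v • coordG) S) (T : Fin 10)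
    (f i j k : Fin 4) (r s : ℕ) {a b : OrientedEdge 10} (h : IsArcFamily T f i j k r s a b) {m : ℕ}
    (hm : m < u * r + v * s) : JoinedIn S (edgeNth S a m) (edgeNth S b m) := by
  obtain ⟨⟨hif, hji, hjf, hki, hkf⟩, ha, hb, rfl, rfl⟩ := h
  rw [← numArcs_smul_add_smul] at hm
  rw [ha.edgeNth_eq, hb.edgeNth_eq]
  exact hS.joinedIn_edgeNth T hif hji hjf hki hkf hm

theorem joinedIn_of_isArcFamily_reverse_right
    (hS : IsNormalSurface triangulationB (u • coordF + v • coordG) S) (T : Fin 10)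
    (f i j k : Fin 4) (r s : ℕ) {a : OrientedEdge 10}
    (h : IsArcFamily T f i j k r s a (edgeRep e').reverse) {m l : ℕ} (hm : m < u * r + v * s)
    (hl : m + l + 1 = numPoints u v e') : JoinedIn S (edgeNth S a m) (edgeNth S (edgeRep e') l) :=
  edgeNth_reverse_edgeRep hS hl ▸ joinedIn_of_isArcFamily hS T f i j k r s h hm

theorem joinedIn_of_isArcFamily_reverse
    (hS : IsNormalSurface triangulationB (u • coordF + v • coordG) S) (T : Fin 10)
    (f i j k : Fin 4) (r s : ℕ)
    (h : IsArcFamily T f i j k r s (edgeRep e).reverse (edgeRep e').reverse) (m : ℕ) {l l' : ℕ}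
    (hm : m < u * r + v * s) (hl : m + l + 1 = numPoints u v e)
    (hl' : m + l' + 1 = numPoints u v e') :
    JoinedIn S (edgeNth S (edgeRep e) l) (edgeNth S (edgeRep e') l') :=
  edgeNth_reverse_edgeRep hS hl ▸
    joinedIn_of_isArcFamily_reverse_right hS T f i j k r s h hm hl'

theorem isArcSystem_edgeNth_edgeRep
    (hS : IsNormalSurface triangulationB (u • coordF + v • coordG) S) :
    IsArcSystem u v (JoinedIn S) fun e m ↦ edgeNth S (edgeRep e) m where
  symm := JoinedIn.symm
  trans := JoinedIn.trans
  arc01 m hm := joinedIn_of_isArcFamily hS 0 3 0 1 2 2 2 (by decide) (by omega)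
  arc02 m hm := joinedIn_of_isArcFamily hS 0 2 0 1 3 2 2 (by decide) (by omega)
  arc04 k l h := joinedIn_of_isArcFamily_reverse_right hS 5 0 2 1 3 2 0 (by decide) (by omega) h
  arc05 m hm := joinedIn_of_isArcFamily_reverse hS 5 0 1 2 3 0 2 (by decide) (2 * v - 1 - m)
    (by omega) (by simp only [numPoints, Matrix.cons_val]; omega)
    (by simp only [numPoints, Matrix.cons_val]; omega)
  arc12 m hm := joinedIn_of_isArcFamily hS 0 1 0 2 3 4 2 (by decide) (by omega)
  arc12' k l h hk :=
    joinedIn_of_isArcFamily_reverse_right hS 1 2 0 3 1 3 1 (by decide) (by omega) h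
  arc13 m hm := joinedIn_of_isArcFamily_reverse hS 0 3 2 0 1 2 2 (by decide)
    (2 * u + 2 * v - 1 - m) (by omega) (by simp only [numPoints, Matrix.cons_val]; omega)
    (by simp only [numPoints, Matrix.cons_val]; omega)
  arc34 m hm := joinedIn_of_isArcFamily hS 0 0 1 2 3 2 0 (by decide) (by omega)
  arc53 k l h hk :=
    joinedIn_of_isArcFamily_reverse_right hS 0 0 2 3 1 0 2 (by decide) (by omega) h
  arc73 k l h := joinedIn_of_isArcFamily_reverse_right hS 2 1 0 3 2 2 2 (by decide) (by omega) h
  arc57 k l h hk :=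
    joinedIn_of_isArcFamily_reverse_right hS 1 0 3 2 1 0 2 (by decide) (by omega) h
  arc77 k l h hk :=
    joinedIn_of_isArcFamily_reverse_right hS 6 3 0 2 1 1 3 (by decide) (by omega) h
  arc27 m hm := joinedIn_of_isArcFamily hS 1 2 1 0 3 1 1 (by decide) (by omega)
  arc67 m hm := joinedIn_of_isArcFamily hS 1 0 1 2 3 2 2 (by decide) (by omega)
  arc28 m hm := joinedIn_of_isArcFamily hS 3 1 0 3 2 3 2 (by decide) (by omega)
  arc68 k l h hk :=
    joinedIn_of_isArcFamily_reverse_right hS 4 2 0 1 3 2 2 (by decide) (by omega) h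
  arc29 k l h := joinedIn_of_isArcFamily_reverse_right hS 6 0 1 3 2 2 2 (by decide) (by omega) h

theorem joinedIn_edgeNth_of_sameEdge_edgeRep (huv : u.Coprime v)
    (hS : IsNormalSurface triangulationB (u • coordF + v • coordG) S) {T : Fin 10} {i j : Fin 4}
    (hij : i ≠ j) (h : triangulationB.SameEdge (edgeRep e) (T, i, j)) {m : ℕ}
    (hm : m < weight ((u • coordF + v • coordG) T) i j) :
    JoinedIn S (edgeNth S (edgeRep 0) 0) (edgeNth S (T, i, j) m) := by
  rw [← hS.weight_eq_of_sameEdge h (edgeRep_ne e) hij, weight_edgeRep] at hm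
  rw [← h.edgeNth_eq]
  exact (isArcSystem_edgeNth_edgeRep hS).rel_of_lt_numPoints huv hm

theorem joinedIn_edgeNth_of_coprime (huv : u.Coprime v)
    (hS : IsNormalSurface triangulationB (u • coordF + v • coordG) S) (T : Fin 10) {i j : Fin 4}
    (hij : i ≠ j) {m : ℕ} (hm : m < weight ((u • coordF + v • coordG) T) i j) :
    JoinedIn S (edgeNth S (edgeRep 0) 0) (edgeNth S (T, i, j) m) := by
  obtain ⟨e, he | he⟩ := exists_sameEdge_edgeRep T i j hij
  · exact joinedIn_edgeNth_of_sameEdge_edgeRep huv hS hij he hm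
  · have hswap := hS.edgeNth_swap T hij.symm (m := weight ((u • coordF + v • coordG) T) i j - 1 - m)
      (m' := m) (by rw [weight_comm _ j]; omega)
    rw [hswap]
    exact joinedIn_edgeNth_of_sameEdge_edgeRep huv hS hij.symm he (by rw [weight_comm _ j]; omega)

theorem isPathConnected_of_coprime (huv : u.Coprime v)
    (hS : IsNormalSurface triangulationB (u • coordF + v • coordG) S) : IsPathConnected S := by
  have hpos : 0 < numPoints u v 0 := by
    have : ¬(u = 0 ∧ v = 0) := by
      rintro ⟨rfl, rfl⟩
      simp at huv
    simp only [numPoints, Matrix.cons_val]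
    omega
  have hbase := (isArcSystem_edgeNth_edgeRep hS).rel_of_lt_numPoints huv hpos
  refine ⟨_, hbase.source_mem, fun {y} hy ↦ ?_⟩
  obtain ⟨T, i, j, m, hij, hm, hjoin⟩ := hS.exists_joinedIn_edgeNth hy
  exact (joinedIn_edgeNth_of_coprime huv hS T hij hm).trans hjoin.symm

end Arcs

end NormalSurfaces

theorem lemma2 (u v : ℕ) (huv : Nat.gcd u v = 1) :
    (∃ S : Set NormalSurfaces.triangulationB.Space,
      NormalSurfaces.IsNormalSurface NormalSurfaces.triangulationB
        (u • NormalSurfaces.coordF + v • NormalSurfaces.coordG) S) ∧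
    ∀ S : Set NormalSurfaces.triangulationB.Space,
      NormalSurfaces.IsNormalSurface NormalSurfaces.triangulationB
        (u • NormalSurfaces.coordF + v • NormalSurfaces.coordG) S →
      IsConnected S :=
  ⟨(NormalSurfaces.matching_coordF.smul_add_smul
      NormalSurfaces.matching_coordG u v).exists_isNormalSurface,
    fun _ hS ↦ (NormalSurfaces.isPathConnected_of_coprime huv hS).isConnected⟩
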